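/- **Theorem (controls under constraints; local minimum).** Let $T>0$, let $\mathbf K\subset\mathbb R^m$ be convex and compact, and let $F$ and $\mathbf f$, with values in $\mathbb R$ and $\mathbb R^N$ respectively, be of class $C^1$ in a neighbourhood of $\mathbb R^N\times\mathbf K$. A *feasible map* is a field $\mathbf u\in L^\infty(0,T;W^{1,\infty}(\mathbb R^N;\mathbf K))$, that is, $\mathbf u(\cdot,\mathbf x)$ is measurable for every $\mathbf x$ and, for a.e. $t\in(0,T)$, $\mathbf u(t,\cdot)$ is $\mathbf K$-valued and Lipschitz with a constant independent of $t$, such that for all $(t,\mathbf y)\in[0,T]\times\mathbb R^N$ the state equation $$\mathbf x'(s)=\mathbf f(\mathbf x(s),\mathbf u(s,\mathbf x(s)))\ \text{ for a.e. } s\in(t,T),\qquad \mathbf x(t)=\mathbf y,$$ has an absolutely continuous solution $\mathbf x$ on $[t,T]$ (the state of $\mathbf u$ from $(t,\mathbf y)$). For such $(t,\mathbf y)$ the cost of $\mathbf u$ is $$I_{t,\mathbf y}(\mathbf u)=\int_t^TF(\mathbf x(s),\mathbf u(s,\mathbf x(s)))\,ds ;$$ the same notation is used for every field $\mathbf w$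 whose state equation is uniquely solvable from $(t,\mathbf y)$ on $[t,T]$. Let $\mathbf u$ be a feasible map and let $\mathbf p:[0,T]\times\mathbb R^N\to\mathbb R^N$ be a costate of $\mathbf u$, i.e. a locally Lipschitz function which satisfies $$\mathbf p_t(t,\mathbf x)+\nabla\mathbf p(t,\mathbf x)\,\mathbf f(\mathbf x,\mathbf u(t,\mathbf x))+\mathbf p(t,\mathbf x)\nabla_{\mathbf x}[\mathbf f(\mathbf x,\mathbf u(t,\mathbf x))]=\nabla_{\mathbf x}[F(\mathbf x,\mathbf u(t,\mathbf x))]$$ for a.e. $(t,\mathbf x)\in(0,T)\times\mathbb R^N$, and $\mathbf p(T,\mathbf x)=0$ for all $\mathbf x$. Suppose that, for a.e. $t\in(0,T)$ and every $\mathbf x\in\mathbb R^N$, $$F(\mathbf x,\mathbf u(t,\mathbf x))-\mathbf p(t,\mathbf x)\,\mathbf f(\mathbf x,\mathbf u(t,\mathbf x))=\min_{\mathbf v\in\mathbf K}\{F(\mathbf x,\mathbf v)-\mathbf p(t,\mathbf x)\,\mathbf f(\mathbf x,\mathbf v)\}.$$ Then: 1. for every feasible map $\mathbf U$ and every $(t,\mathbf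 y)\in[0,T]\times\mathbb R^N$, the state of $\mathbf u+\epsilon(\mathbf U-\mathbf u)$ from $(t,\mathbf y)$ exists on $[t,T]$ for all sufficiently small $\epsilon\ge0$, and the first variation exists, is given by the following convergent integral, and is nonnegative: $$\left.\frac{d}{d\epsilon}I_{t,\mathbf y}(\mathbf u+\epsilon(\mathbf U-\mathbf u))\right|_{\epsilon=0^+}=\int_t^T\left[F_{\mathbf u}-\mathbf p\,\mathbf f_{\mathbf u}\right](\mathbf U-\mathbf u)\,ds\ \ge\ 0,$$ where $F_{\mathbf u},\mathbf f_{\mathbf u}$ are the derivatives with respect to the control, evaluated at $(\mathbf x(s),\mathbf u(s,\mathbf x(s)))$, $\mathbf p,\mathbf U,\mathbf u$ are evaluated at $(s,\mathbf x(s))$, and $\mathbf x$ is the state of $\mathbf u$ from $(t,\mathbf y)$; 2. $\mathbf u$ is a local minimum of the feedback optimal control problem: there is $\delta>0$ such that $I_{t,\mathbf y}(\mathbf u)\le I_{t,\mathbf y}(\mathbf U)$ for all $(t,\mathbf y)\in[0,T]\times\mathbb R^N$ and every feasible map $\mathbf U$ with $|\mathbf U(t,\mathbf x)-\mathbf u(t,\mathbf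 x)|\le\delta$ for a.e. $t\in(0,T)$ and all $\mathbf x\in\mathbb R^N$. -/

import Mathlib

open MeasureTheory Set Filter Topology
open scoped NNReal

/-- Feedback fields `w : [0, T] × E → M` are written in curried form. -/
abbrev FeedbackField (E M : Type*) := ℝ → E → M

section FeedbackControl

variable {N m : ℕ}

/-- `x` is the (Carathéodory) solution on `[t, T]` of the state equation
`x'(s) = f (x(s), w(s, x(s)))`, `x(t) = y`, i.e. `x` is absolutely continuous on `[t, T]` and
satisfies the equation almost everywhere; this is written in integrated form. -/
structure IsState
    (f : EuclideanSpace ℝ (Fin N) → EuclideanSpace ℝ (Fin m) → EuclideanSpace ℝ (Fin N))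
    (w : FeedbackField (EuclideanSpace ℝ (Fin N)) (EuclideanSpace ℝ (Fin m)))
    (T t : ℝ) (y : EuclideanSpace ℝ (Fin N)) (x : ℝ → EuclideanSpace ℝ (Fin N)) : Prop where
  continuousOn : ContinuousOn x (Icc t T)
  integrable : IntervalIntegrable (fun r => f (x r) (w r (x r))) volume t T
  eq_integral : ∀ s ∈ Icc t T, x s = y + ∫ r in t..s, f (x r) (w r (x r))

/-- The state associated with the field `w` and the initial condition `x(t) = y`
(meaningful when such a state exists). -/
noncomputable def stateOf
    (f : EuclideanSpace ℝ (Fin N) → EuclideanSpace ℝ (Fin m) → EuclideanSpace ℝ (Fin N))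
    (w : FeedbackField (EuclideanSpace ℝ (Fin N)) (EuclideanSpace ℝ (Fin m)))
    (T t : ℝ) (y : EuclideanSpace ℝ (Fin N)) : ℝ → EuclideanSpace ℝ (Fin N) :=
  Classical.epsilon (IsState f w T t y)

/-- The cost `∫_t^T F (x(s), w(s, x(s))) ds`, where `x` is the state of `w` with `x(t) = y`. -/
noncomputable def feedbackCost
    (F : EuclideanSpace ℝ (Fin N) → EuclideanSpace ℝ (Fin m) → ℝ)
    (f : EuclideanSpace ℝ (Fin N) → EuclideanSpace ℝ (Fin m) → EuclideanSpace ℝ (Fin N))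
    (T t : ℝ) (y : EuclideanSpace ℝ (Fin N))
    (w : FeedbackField (EuclideanSpace ℝ (Fin N)) (EuclideanSpace ℝ (Fin m))) : ℝ :=
  ∫ s in t..T, F (stateOf f w T t y s) (w s (stateOf f w T t y s))

/-- Feasible maps: elements of `L^∞(0, T; W^{1,∞}(ℝ^N; K))` (with `K` bounded, this means values in
`K` and a Lipschitz constant in `x` that is uniform in `t`), for which the state equation can be
solved on `[t, T]` from every initial condition `(t, y)`. -/
structure IsFeasible
    (f : EuclideanSpace ℝ (Fin N) → EuclideanSpace ℝ (Fin m) → EuclideanSpace ℝ (Fin N))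
    (K : Set (EuclideanSpace ℝ (Fin m))) (T : ℝ)
    (w : FeedbackField (EuclideanSpace ℝ (Fin N)) (EuclideanSpace ℝ (Fin m))) : Prop where
  aemeasurable : ∀ x, AEMeasurable (fun t => w t x) (volume.restrict (Ioo 0 T))
  mem : ∀ᵐ t, t ∈ Ioo 0 T → ∀ x, w t x ∈ K
  lipschitz : ∃ L : ℝ≥0, ∀ᵐ t, t ∈ Ioo 0 T → LipschitzWith L (w t)
  exists_state : ∀ t ∈ Icc 0 T, ∀ y, ∃ x, IsState f w T t y x

/-- `p` is a locally Lipschitz solution on `[0, T] × ℝ^N` of the linear transport system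
`p_t + ∇p f(x, u) + p ∇ₓ[f(x, u(t, x))] = ∇ₓ[F(x, u(t, x))]`, `p(T, x) = 0`, the equation being
satisfied almost everywhere. The row vector `p ∇ₓ[f]` is the transposed Jacobian applied to `p`. -/
structure IsCostate
    (F : EuclideanSpace ℝ (Fin N) → EuclideanSpace ℝ (Fin m) → ℝ)
    (f : EuclideanSpace ℝ (Fin N) → EuclideanSpace ℝ (Fin m) → EuclideanSpace ℝ (Fin N))
    (T : ℝ) (u : FeedbackField (EuclideanSpace ℝ (Fin N)) (EuclideanSpace ℝ (Fin m)))
    (p : FeedbackField (EuclideanSpace ℝ (Fin N)) (EuclideanSpace ℝ (Fin N))) : Prop where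
  locallyLipschitz : LocallyLipschitzOn (Icc 0 T ×ˢ univ) (Function.uncurry p)
  transport : ∀ᵐ z : ℝ × EuclideanSpace ℝ (Fin N), z.1 ∈ Ioo 0 T →
    deriv (fun s => p s z.2) z.1
      + fderiv ℝ (p z.1) z.2 (f z.2 (u z.1 z.2))
      + ContinuousLinearMap.adjoint (fderiv ℝ (fun x => f x (u z.1 x)) z.2) (p z.1 z.2)
      = gradient (fun x => F x (u z.1 x)) z.2
  terminal : ∀ x, p T x = 0

/-- The hamiltonian `F(x, v) - p(t, x) f(x, v)`. -/
noncomputable def hamiltonian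
    (F : EuclideanSpace ℝ (Fin N) → EuclideanSpace ℝ (Fin m) → ℝ)
    (f : EuclideanSpace ℝ (Fin N) → EuclideanSpace ℝ (Fin m) → EuclideanSpace ℝ (Fin N))
    (p : FeedbackField (EuclideanSpace ℝ (Fin N)) (EuclideanSpace ℝ (Fin N)))
    (t : ℝ) (x : EuclideanSpace ℝ (Fin N)) (v : EuclideanSpace ℝ (Fin m)) : ℝ :=
  F x v - inner ℝ (p t x) (f x v)

/-- The row vector `∇I(u)(t, x) = F_u(x, u(t, x)) - p(t, x) f_u(x, u(t, x))`. -/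
noncomputable def costGradient
    (F : EuclideanSpace ℝ (Fin N) → EuclideanSpace ℝ (Fin m) → ℝ)
    (f : EuclideanSpace ℝ (Fin N) → EuclideanSpace ℝ (Fin m) → EuclideanSpace ℝ (Fin N))
    (p : FeedbackField (EuclideanSpace ℝ (Fin N)) (EuclideanSpace ℝ (Fin N)))
    (u : FeedbackField (EuclideanSpace ℝ (Fin N)) (EuclideanSpace ℝ (Fin m)))
    (t : ℝ) (x : EuclideanSpace ℝ (Fin N)) : EuclideanSpace ℝ (Fin m) →L[ℝ] ℝ :=
  fderiv ℝ (F x) (u t x) - (innerSL ℝ (p t x)).comp (fderiv ℝ (f x) (u t x))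

/-- The variation `u + ε (U - u)`. -/
def variationField (u U : FeedbackField (EuclideanSpace ℝ (Fin N)) (EuclideanSpace ℝ (Fin m)))
    (ε : ℝ) : FeedbackField (EuclideanSpace ℝ (Fin N)) (EuclideanSpace ℝ (Fin m)) :=
  fun t x => u t x + ε • (U t x - u t x)

/-- `u` is a local minimum of the feedback problem: among the feasible maps in some
`L^∞`-neighbourhood of `u`, it minimizes all the costs, for all initial conditions `(t, y)`,
simultaneously. -/
def IsLocalMinFeedback
    (F : EuclideanSpace ℝ (Fin N) → EuclideanSpace ℝ (Fin m) → ℝ)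
    (f : EuclideanSpace ℝ (Fin N) → EuclideanSpace ℝ (Fin m) → EuclideanSpace ℝ (Fin N))
    (K : Set (EuclideanSpace ℝ (Fin m))) (T : ℝ)
    (u : FeedbackField (EuclideanSpace ℝ (Fin N)) (EuclideanSpace ℝ (Fin m))) : Prop :=
  IsFeasible f K T u ∧
    ∃ δ > 0, ∀ U, IsFeasible f K T U →
      (∀ᵐ t, t ∈ Ioo 0 T → ∀ x, ‖U t x - u t x‖ ≤ δ) →
      ∀ t ∈ Icc 0 T, ∀ y, feedbackCost F f T t y u ≤ feedbackCost F f T t y U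

end FeedbackControl

/-!
The whole theorem rests on one identity. Write `V(t, y)` for the cost of `u` from `(t, y)` and
`H(t, x, v) = F(x, v) - p(t, x) f(x, v)`. For every feedback `w`, with state `X` from `(t, y)`,
`I(w) - I(u) = ∫_t^T [H(s, X, w(s, X)) - H(s, X, u(s, X))] ds`
(`feedbackCost_eq_add_integral_hamiltonian`). Since `u` minimizes `H` pointwise, `u` is optimal
among all feasible maps, not only the nearby ones (`feedbackCost_le_of_isMinOn`). Applied to
`w = u + ε (U - u)`, the identity also gives the first variation: dividing by `ε` and passing to
the limit by dominated convergence involves the derivatives of `F` and `f` in the control only,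
because `X` converges uniformly to the state of `u` (`hasDerivWithinAt_feedbackCost`).

The identity says that `V` decreases along `X` at the rate `F(X, u) + p (f(X, w) - f(X, u))`, which
amounts to `∇V = -p` (`IsAdjointState.value_eq_integral`). The transport system holds only almost
everywhere, whereas the curve `X` is a null set, so `∇V = -p` is needed at every point. It is first
proved almost everywhere (`IsAdjointState.ae_hasFDerivAt_value`). The flow of `u` is locally
bi-Lipschitz, hence along the trajectory `x` from almost every `y` the costate is differentiable and
satisfies its equation at almost every time (`IsFlowFrom.ae_ae`). If `δ` is the increment of the
trajectory when `y` moves to `y'`, the absolutely continuous function `p(s, x(s)) · δ(s)` vanishes at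
`T`, equals `p(t, y) · (y' - y)` at `t`, and its derivative differs from the increment of the running
cost by `o(δ)`. As `V(t, ·)` is locally Lipschitz and `p(t, ·)` is continuous, the gradient formula
then extends to all points (`hasFDerivAt_of_ae_hasFDerivAt`).

The state equation is a Carathéodory equation with a merely locally Lipschitz right-hand side.
Stability under perturbations of the field and of the initial point (`IsTrajectory.norm_sub_le`) is
obtained from Grönwall's inequality and a continuity argument, and the states of the variations
`u + ε (U - u)` from a Picard iteration for a truncated field
(`IsCaratheodoryField.exists_isTrajectory_near`).
Feasible maps are only regular for almost every time; they are first modified on a null set of times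
so as to become jointly measurable (`exists_isRegularControl`), which changes neither states nor
costs.
-/

set_option linter.unusedSectionVars false

/-! ### Grönwall inequalities in integral form -/

/-- Grönwall's inequality in integral form; nothing is assumed about the derivative of `φ`, so it
applies to solutions of Carathéodory equations. -/
theorem le_mul_exp_of_le_integral {φ : ℝ → ℝ} {a b c L : ℝ} (hL : 0 ≤ L)
    (hφ : ContinuousOn φ (Icc a b))
    (h : ∀ s ∈ Icc a b, φ s ≤ c + L * ∫ r in a..s, φ r) :
    ∀ s ∈ Icc a b, φ s ≤ c * Real.exp (L * (s - a)) := by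
  intro s hs
  have hab : a ≤ b := hs.1.trans hs.2
  set ψ : ℝ → ℝ := IccExtend hab ((Icc a b).domRestrict φ) with hψ
  have hψc : Continuous ψ := (continuousOn_iff_continuous_domRestrict.1 hφ).Icc_extend'
  have hψe : ∀ r ∈ Icc a b, ψ r = φ r := fun r hr => by
    rw [hψ, IccExtend_of_mem hab _ hr]; rfl
  have hint : ∀ s ∈ Icc a b, ∫ r in a..s, ψ r = ∫ r in a..s, φ r := fun s hs => by
    refine intervalIntegral.integral_congr fun r hr => hψe r ?_
    rw [uIcc_of_le hs.1] at hr
    exact ⟨hr.1, hr.2.trans hs.2⟩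
  set Ψ : ℝ → ℝ := fun s => c + L * ∫ r in a..s, ψ r with hΨ
  have hd : ∀ s, HasDerivAt (fun s => Ψ s * Real.exp (-(L * (s - a))))
      (L * ψ s * Real.exp (-(L * (s - a)))
        + Ψ s * (Real.exp (-(L * (s - a))) * (-(L * 1)))) s := fun s => by
    have h1 : HasDerivAt Ψ (L * ψ s) s :=
      ((hψc.integral_hasStrictDerivAt a s).hasDerivAt.const_mul L).const_add c
    exact h1.mul ((((hasDerivAt_id s).sub_const a).const_mul L).neg.exp)
  have hanti : AntitoneOn (fun s => Ψ s * Real.exp (-(L * (s - a)))) (Icc a b) := by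
    refine antitoneOn_of_deriv_nonpos (convex_Icc a b)
      (fun s _ => (hd s).continuousAt.continuousWithinAt)
      (fun s _ => (hd s).differentiableAt.differentiableWithinAt) fun s hs => ?_
    rw [interior_Icc] at hs
    have hs' := Ioo_subset_Icc_self hs
    rw [(hd s).deriv]
    have h1 : ψ s ≤ Ψ s := by
      rw [hψe s hs', hΨ]; simp only; rw [hint s hs']; exact h s hs'
    have h2 := Real.exp_pos (-(L * (s - a)))
    have h3 : 0 ≤ L * (Ψ s - ψ s) * Real.exp (-(L * (s - a))) :=
      mul_nonneg (mul_nonneg hL (sub_nonneg.2 h1)) h2.le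
    linarith
  have h1 := hanti (left_mem_Icc.2 hab) hs hs.1
  have h2 : φ s ≤ Ψ s := by rw [hΨ]; simp only; rw [hint s hs]; exact h s hs
  simp only [hΨ, intervalIntegral.integral_same, mul_zero, add_zero, sub_self, neg_zero,
    Real.exp_zero, mul_one] at h1
  rw [Real.exp_neg, ← div_eq_mul_inv, div_le_iff₀ (Real.exp_pos _)] at h1
  exact h2.trans h1

/-- The version of Grönwall's inequality that runs backwards from the right endpoint. -/
theorem le_mul_exp_of_le_integral_right {φ : ℝ → ℝ} {a b c L : ℝ} (hL : 0 ≤ L)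
    (hφ : ContinuousOn φ (Icc a b))
    (h : ∀ s ∈ Icc a b, φ s ≤ c + L * ∫ r in s..b, φ r) :
    ∀ s ∈ Icc a b, φ s ≤ c * Real.exp (L * (b - s)) := by
  intro s hs
  have hmaps : MapsTo (fun r => a + b - r) (Icc a b) (Icc a b) := fun r hr =>
    ⟨by linarith [hr.2], by linarith [hr.1]⟩
  have := le_mul_exp_of_le_integral (φ := fun r => φ (a + b - r)) (a := a) (b := b) (c := c) hL
    (hφ.comp (by fun_prop) hmaps) (fun r hr => by
      have h1 := h _ (hmaps hr)
      rw [intervalIntegral.integral_comp_sub_left (fun r => φ r)]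
      simpa using h1) (a + b - s) (hmaps hs)
  simp only [sub_sub_cancel] at this
  convert this using 3
  ring

/-- A continuity argument: if `φ ≤ ρ` on `[a, s]` always improves to `φ s ≤ θ` with `θ < ρ`, then
`φ ≤ θ` on the whole interval. -/
theorem le_of_continuity_argument {φ : ℝ → ℝ} {a b θ ρ : ℝ} (hφ : ContinuousOn φ (Icc a b))
    (hθ : θ < ρ) (ha : φ a ≤ ρ)
    (h : ∀ s ∈ Icc a b, (∀ r ∈ Icc a s, φ r ≤ ρ) → φ s ≤ θ) :
    ∀ s ∈ Icc a b, φ s ≤ θ := by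
  intro s hs
  by_contra! hlt
  have hab : a ≤ b := hs.1.trans hs.2
  have ha' : φ a ≤ θ := h a (left_mem_Icc.2 hab) fun r hr => by
    rw [le_antisymm hr.2 hr.1]; exact ha
  set η := min ρ (φ s) with hη
  have hη1 : θ < η := lt_min hθ hlt
  have hcpt : IsCompact (Icc a b ∩ φ ⁻¹' {η}) :=
    isCompact_Icc.of_isClosed_subset
      (hφ.preimage_isClosed_of_isClosed isClosed_Icc isClosed_singleton) inter_subset_left
  have hex : ∀ s ∈ Icc a b, η ≤ φ s → ∃ r ∈ Icc a s, φ r = η := fun s hs hs' =>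
    intermediate_value_Icc hs.1 (hφ.mono (Icc_subset_Icc_right hs.2)) ⟨ha'.trans hη1.le, hs'⟩
  obtain ⟨r, hr, hrη⟩ := hex s hs (min_le_right _ _)
  obtain ⟨m, ⟨hm, hmη⟩, hmin⟩ := hcpt.exists_isLeast ⟨r, ⟨hr.1, hr.2.trans hs.2⟩, hrη⟩
  have hmη : φ m = η := hmη
  have := h m hm fun r hr => by
    by_contra! hlt'
    have hrb : r ∈ Icc a b := ⟨hr.1, hr.2.trans hm.2⟩
    obtain ⟨q, hq, hqη⟩ := hex r hrb ((min_le_left _ _).trans hlt'.le)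
    have hmq : m ≤ q := hmin ⟨⟨hq.1, hq.2.trans hrb.2⟩, hqη⟩
    have : r = m := le_antisymm hr.2 (hmq.trans hq.2)
    rw [this, hmη] at hlt'
    exact absurd (min_le_left ρ (φ s)) (not_le.2 hlt')
  linarith

/-! ### Carathéodory fields and their trajectories -/

theorem ContinuousOn.exists_norm_le_Icc {E : Type*} [SeminormedAddCommGroup E] {x : ℝ → E}
    {a b : ℝ} (hx : ContinuousOn x (Icc a b)) : ∃ R : ℝ, 0 ≤ R ∧ ∀ s ∈ Icc a b, ‖x s‖ ≤ R := by
  obtain ⟨R, hR⟩ := isCompact_Icc.exists_bound_of_continuousOn hx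
  exact ⟨max R 0, le_max_right _ _, fun s hs => (hR s hs).trans (le_max_left _ _)⟩

theorem Measurable.aestronglyMeasurable_comp_Icc {E F : Type*} [TopologicalSpace E]
    [TopologicalSpace.PseudoMetrizableSpace E] [MeasurableSpace E] [BorelSpace E]
    [TopologicalSpace F] [TopologicalSpace.PseudoMetrizableSpace F] [SecondCountableTopology F]
    [MeasurableSpace F] [OpensMeasurableSpace F] {g : ℝ → E → F}
    (hg : Measurable (Function.uncurry g))
    {x : ℝ → E} {a b : ℝ} (hx : ContinuousOn x (Icc a b)) :
    AEStronglyMeasurable (fun r => g r (x r)) (volume.restrict (Icc a b)) := by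
  have h1 : AEMeasurable x (volume.restrict (Icc a b)) := hx.aemeasurable measurableSet_Icc
  exact (hg.comp_aemeasurable (aemeasurable_id.prodMk h1)).aestronglyMeasurable

theorem intervalIntegrable_of_norm_le {F : Type*} [NormedAddCommGroup F] {h : ℝ → F}
    {a b M : ℝ} (hab : a ≤ b)
    (hm : AEStronglyMeasurable h (volume.restrict (Icc a b))) (hM : ∀ r ∈ Icc a b, ‖h r‖ ≤ M) :
    IntervalIntegrable h volume a b := by
  rw [intervalIntegrable_iff_integrableOn_Icc_of_le hab]
  exact Integrable.of_bound hm M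
    ((ae_restrict_iff' measurableSet_Icc).2 (ae_of_all _ hM))

section Caratheodory

variable {E F : Type*} [NormedAddCommGroup E] [InnerProductSpace ℝ E] [FiniteDimensional ℝ E]
  [MeasurableSpace E] [BorelSpace E] [NormedAddCommGroup F] [InnerProductSpace ℝ F]
  [FiniteDimensional ℝ F] [MeasurableSpace F] [BorelSpace F]

/-- Time-dependent fields that are jointly measurable, and Lipschitz and bounded on balls,
uniformly in time. -/
structure IsCaratheodoryField (g : ℝ → E → F) : Prop where
  measurable : Measurable (Function.uncurry g)
  lipschitz : ∀ R : ℝ, ∃ L : ℝ≥0, ∀ t, LipschitzOnWith L (g t) (Metric.closedBall 0 R)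
  bounded : ∀ R : ℝ, ∃ M : ℝ, ∀ t, ∀ x ∈ Metric.closedBall 0 R, ‖g t x‖ ≤ M

/-- `x` is an absolutely continuous solution of `x' = g (s, x)` on `[a, b]`, the equation being
written in integrated form. -/
structure IsTrajectory (g : ℝ → E → E) (a b : ℝ) (x : ℝ → E) : Prop where
  continuousOn : ContinuousOn x (Icc a b)
  eq_integral : ∀ s ∈ Icc a b, x s = x a + ∫ r in a..s, g r (x r)

theorem IsCaratheodoryField.intervalIntegrable {g : ℝ → E → F} (hg : IsCaratheodoryField g)
    {x : ℝ → E} {a b : ℝ} (hab : a ≤ b) (hx : ContinuousOn x (Icc a b)) :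
    IntervalIntegrable (fun r => g r (x r)) volume a b := by
  obtain ⟨R, -, hR⟩ := hx.exists_norm_le_Icc
  obtain ⟨M, hM⟩ := hg.bounded R
  exact intervalIntegrable_of_norm_le hab (hg.measurable.aestronglyMeasurable_comp_Icc hx)
    fun r hr => hM r _ (by simpa using hR r hr)

theorem IsTrajectory.integral_eq_sub {g : ℝ → E → E} (hg : IsCaratheodoryField g) {a b : ℝ}
    {x : ℝ → E} (hx : IsTrajectory g a b x) {s s' : ℝ} (hs : a ≤ s) (hss : s ≤ s') (hs' : s' ≤ b) :
    ∫ r in s..s', g r (x r) = x s' - x s := by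
  have hint := hg.intervalIntegrable (hs.trans (hss.trans hs')) hx.continuousOn
  have h1 := hx.eq_integral s ⟨hs, hss.trans hs'⟩
  have h2 := hx.eq_integral s' ⟨hs.trans hss, hs'⟩
  have h3 := intervalIntegral.integral_add_adjacent_intervals
    (hint.mono_set (a := a) (b := b) (c := a) (d := s)
      (by rw [uIcc_of_le hs, uIcc_of_le (by linarith)]; exact Icc_subset_Icc_right (by linarith)))
    (hint.mono_set (a := a) (b := b) (c := s) (d := s')
      (by rw [uIcc_of_le hss, uIcc_of_le (by linarith)]; exact Icc_subset_Icc hs hs'))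
  rw [h1, h2, ← h3]
  abel

theorem IsTrajectory.mono {g : ℝ → E → E} (hg : IsCaratheodoryField g) {a b : ℝ}
    {x : ℝ → E} (hx : IsTrajectory g a b x) {a' b' : ℝ} (ha : a ≤ a') (hb : b' ≤ b) :
    IsTrajectory g a' b' x where
  continuousOn := hx.continuousOn.mono (Icc_subset_Icc ha hb)
  eq_integral s hs := by
    rw [hx.integral_eq_sub hg ha hs.1 (hs.2.trans hb)]; abel

theorem IsTrajectory.lipschitzOnWith {g : ℝ → E → E} (hg : IsCaratheodoryField g) {a b : ℝ}
    {x : ℝ → E} (hx : IsTrajectory g a b x) : ∃ C : ℝ≥0, LipschitzOnWith C x (Icc a b) := by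
  obtain ⟨R, -, hR⟩ := hx.continuousOn.exists_norm_le_Icc
  obtain ⟨M, hM⟩ := hg.bounded R
  have key : ∀ s ∈ Icc a b, ∀ s' ∈ Icc a b, s ≤ s' → ‖x s' - x s‖ ≤ M * (s' - s) := by
    intro s hs s' hs' hss
    rw [← hx.integral_eq_sub hg hs.1 hss hs'.2, ← abs_of_nonneg (sub_nonneg.2 hss)]
    refine intervalIntegral.norm_integral_le_of_norm_le_const fun r hr => ?_
    rw [uIoc_of_le hss] at hr
    exact hM r _ (by simpa using hR r ⟨hs.1.trans hr.1.le, hr.2.trans hs'.2⟩)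
  refine ⟨M.toNNReal, LipschitzOnWith.of_dist_le_mul fun s hs s' hs' => ?_⟩
  have hMM : M ≤ M.toNNReal := Real.le_coe_toNNReal M
  rcases le_total s s' with h | h
  · rw [dist_comm s, dist_comm (x s), dist_eq_norm, Real.dist_eq, abs_of_nonneg (sub_nonneg.2 h)]
    exact (key s hs s' hs' h).trans (mul_le_mul_of_nonneg_right hMM (sub_nonneg.2 h))
  · rw [dist_eq_norm, Real.dist_eq, abs_of_nonneg (sub_nonneg.2 h)]
    exact (key s' hs' s hs h).trans (mul_le_mul_of_nonneg_right hMM (sub_nonneg.2 h))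

/-- Stability of trajectories. The curve `X` has velocity `w`, which differs from the field `g` by
at most `M`; as long as the Grönwall bound is less than `1`, the trajectory `x` stays within it
of `X`, and so the Lipschitz constant of `g` is only needed on a ball around the curve `X`. -/
theorem IsTrajectory.norm_sub_le {g : ℝ → E → E} (hg : IsCaratheodoryField g) {a b R M c : ℝ}
    {L : ℝ≥0} (hL : ∀ t, LipschitzOnWith L (g t) (Metric.closedBall 0 (R + 1))) {x X w : ℝ → E}
    (hx : IsTrajectory g a b x) (hXc : ContinuousOn X (Icc a b)) (hXR : ∀ s ∈ Icc a b, ‖X s‖ ≤ R)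
    (hw : IntervalIntegrable w volume a b) (hX : ∀ s ∈ Icc a b, X s = X a + ∫ r in a..s, w r)
    (hwM : ∀ r ∈ Icc a b, ‖w r - g r (X r)‖ ≤ M) (hM : 0 ≤ M)
    (hc : (‖x a - X a‖ + M * (b - a)) * Real.exp (L * (b - a)) ≤ c) (hc1 : c < 1) :
    ∀ s ∈ Icc a b, ‖x s - X s‖ ≤ c := by
  rcases lt_or_ge b a with hab | hab
  · intro s hs; exact absurd (hs.1.trans hs.2) (not_le.2 hab)
  have hφ : ContinuousOn (fun s => ‖x s - X s‖) (Icc a b) := (hx.continuousOn.sub hXc).norm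
  have hexp : (1 : ℝ) ≤ Real.exp (L * (b - a)) :=
    Real.one_le_exp (mul_nonneg L.2 (sub_nonneg.2 hab))
  have hA : 0 ≤ ‖x a - X a‖ + M * (b - a) :=
    add_nonneg (norm_nonneg _) (mul_nonneg hM (sub_nonneg.2 hab))
  have hAc : ‖x a - X a‖ ≤ c := by
    nlinarith [mul_nonneg hM (sub_nonneg.2 hab)]
  refine le_of_continuity_argument hφ hc1 (hAc.trans hc1.le) fun s hs hle => ?_
  have hsub : Icc a s ⊆ Icc a b := Icc_subset_Icc_right hs.2
  have hgx := hg.intervalIntegrable hab hx.continuousOn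
  have key := le_mul_exp_of_le_integral (φ := fun s => ‖x s - X s‖) (a := a) (b := s)
    (c := ‖x a - X a‖ + M * (b - a)) (L := (L : ℝ)) L.2 (hφ.mono hsub) (fun q hq => by
      have hqb := hsub hq
      have hu : uIcc a q ⊆ uIcc a b := by
        rw [uIcc_of_le hq.1, uIcc_of_le hab]; exact Icc_subset_Icc_right hqb.2
      have h1 := hgx.mono_set hu
      have h2 := hw.mono_set hu
      have h3 : x q - X q = (x a - X a) + ∫ r in a..q, (g r (x r) - w r) := by
        rw [intervalIntegral.integral_sub h1 h2, hx.eq_integral q hqb, hX q hqb]; abel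
      have hint : IntervalIntegrable (fun r => ‖x r - X r‖) volume a q :=
        ContinuousOn.intervalIntegrable (by
          rw [uIcc_of_le hq.1]; exact hφ.mono (Icc_subset_Icc_right hqb.2))
      have h4 : ‖∫ r in a..q, (g r (x r) - w r)‖ ≤ ∫ r in a..q, (L * ‖x r - X r‖ + M) := by
        refine intervalIntegral.norm_integral_le_of_norm_le hq.1 (ae_of_all _ fun r hr => ?_)
          ((hint.const_mul _).add intervalIntegrable_const)
        have hrs : r ∈ Icc a s := ⟨hr.1.le, hr.2.trans hq.2⟩
        have hXr := hXR r (hsub hrs)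
        have h5 : ‖g r (x r) - g r (X r)‖ ≤ L * ‖x r - X r‖ := by
          refine (hL r).norm_sub_le ?_ ?_
          · have := norm_add_le (X r) (x r - X r)
            rw [add_sub_cancel] at this
            have := hle r hrs
            rw [mem_closedBall_zero_iff]; linarith
          · rw [mem_closedBall_zero_iff]; linarith
        calc ‖g r (x r) - w r‖ = ‖(g r (x r) - g r (X r)) - (w r - g r (X r))‖ := by congr 1; abel
          _ ≤ _ := _root_.norm_sub_le _ _
          _ ≤ _ := add_le_add h5 (hwM r (hsub hrs))
      rw [intervalIntegral.integral_add (hint.const_mul _) intervalIntegrable_const,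
        intervalIntegral.integral_const_mul, intervalIntegral.integral_const, smul_eq_mul] at h4
      simp only [h3]
      have h5 := norm_add_le (x a - X a) (∫ r in a..q, (g r (x r) - w r))
      have h6 : (q - a) * M ≤ M * (b - a) := by
        rw [mul_comm]; exact mul_le_mul_of_nonneg_left (by linarith [hqb.2]) hM
      have h7 : ∫ r in a..q, ‖x r - X r‖ =
        ∫ r in a..q, (fun s => ‖x s - X s‖) r := rfl
      linarith) s (right_mem_Icc.2 hs.1)
  refine (key.trans (mul_le_mul_of_nonneg_left ?_ hA)).trans hc
  exact Real.exp_le_exp.2 (mul_le_mul_of_nonneg_left (by linarith [hs.2]) L.2)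

/-- Two trajectories in a ball cannot approach each other faster than exponentially. -/
theorem IsTrajectory.norm_sub_le_right {g : ℝ → E → E} (hg : IsCaratheodoryField g) {a b R : ℝ}
    {L : ℝ≥0} (hL : ∀ t, LipschitzOnWith L (g t) (Metric.closedBall 0 R)) {x x' : ℝ → E}
    (hx : IsTrajectory g a b x) (hx' : IsTrajectory g a b x')
    (hR : ∀ s ∈ Icc a b, ‖x s‖ ≤ R) (hR' : ∀ s ∈ Icc a b, ‖x' s‖ ≤ R) (hab : a ≤ b) :
    ‖x a - x' a‖ ≤ ‖x b - x' b‖ * Real.exp (L * (b - a)) := by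
  have hφ : ContinuousOn (fun s => ‖x s - x' s‖) (Icc a b) :=
    (hx.continuousOn.sub hx'.continuousOn).norm
  refine le_mul_exp_of_le_integral_right (φ := fun s => ‖x s - x' s‖) (L := (L : ℝ)) L.2 hφ
    (fun q hq => ?_) a (left_mem_Icc.2 hab)
  have h1 := hx.integral_eq_sub hg hq.1 hq.2 le_rfl
  have h2 := hx'.integral_eq_sub hg hq.1 hq.2 le_rfl
  have hsub : Icc q b ⊆ Icc a b := Icc_subset_Icc_left hq.1
  have i1 := hg.intervalIntegrable hq.2 (hx.continuousOn.mono hsub)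
  have i2 := hg.intervalIntegrable hq.2 (hx'.continuousOn.mono hsub)
  have h3 : x q - x' q = (x b - x' b) - ∫ r in q..b, (g r (x r) - g r (x' r)) := by
    rw [intervalIntegral.integral_sub i1 i2, h1, h2]; abel
  have hint : IntervalIntegrable (fun r => ‖x r - x' r‖) volume q b :=
    ContinuousOn.intervalIntegrable (by rw [uIcc_of_le hq.2]; exact hφ.mono hsub)
  have h4 : ‖∫ r in q..b, (g r (x r) - g r (x' r))‖ ≤ ∫ r in q..b, L * ‖x r - x' r‖ := by
    refine intervalIntegral.norm_integral_le_of_norm_le hq.2 (ae_of_all _ fun r hr => ?_)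
      (hint.const_mul _)
    have hr' : r ∈ Icc a b := hsub ⟨hr.1.le, hr.2⟩
    exact (hL r).norm_sub_le (by simpa using hR r hr') (by simpa using hR' r hr')
  rw [intervalIntegral.integral_const_mul] at h4
  simp only [h3]
  exact (_root_.norm_sub_le _ _).trans (add_le_add le_rfl h4)

theorem IsTrajectory.eqOn {g : ℝ → E → E} (hg : IsCaratheodoryField g) {a b : ℝ} {x x' : ℝ → E}
    (hx : IsTrajectory g a b x) (hx' : IsTrajectory g a b x') (h : x a = x' a) :
    EqOn x x' (Icc a b) := by
  intro s hs
  have hab : a ≤ b := hs.1.trans hs.2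
  obtain ⟨R, -, hR⟩ := hx'.continuousOn.exists_norm_le_Icc
  obtain ⟨L, hL⟩ := hg.lipschitz (R + 1)
  have := hx.norm_sub_le hg hL (M := 0) (c := 0) hx'.continuousOn hR
    (hg.intervalIntegrable hab hx'.continuousOn) hx'.eq_integral (by simp) le_rfl (by simp [h])
    one_pos s hs
  simpa [sub_eq_zero] using this

end Caratheodory

/-! ### Existence of trajectories -/

/-- The radial retraction onto a closed ball is Lipschitz. -/
theorem exists_lipschitzWith_retraction_closedBall {E : Type*} [NormedAddCommGroup E]
    [NormedSpace ℝ E] {R : ℝ} (hR : 0 < R) :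
    ∃ π : E → E, LipschitzWith 2 π ∧ (∀ x, π x ∈ Metric.closedBall 0 R) ∧
      ∀ x ∈ Metric.closedBall 0 R, π x = x := by
  have hm : ∀ x : E, 0 < max R ‖x‖ := fun x => lt_max_of_lt_left hR
  refine ⟨fun x => (R / max R ‖x‖) • x, LipschitzWith.of_dist_le_mul fun x y => ?_, fun x => ?_,
    fun x hx => ?_⟩
  · have hx := hm x
    have hy := hm y
    have hc : R / max R ‖x‖ ≤ 1 := (div_le_one hx).2 (le_max_left _ _)
    have hc0 : 0 ≤ R / max R ‖x‖ := by positivity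
    have h1 : (R / max R ‖x‖) • x - (R / max R ‖y‖) • y
        = (R / max R ‖x‖) • (x - y) + (R / max R ‖x‖ - R / max R ‖y‖) • y := by
      rw [smul_sub, sub_smul]; abel
    have h2 : R / max R ‖x‖ - R / max R ‖y‖
        = R / max R ‖x‖ * ((max R ‖y‖ - max R ‖x‖) / max R ‖y‖) := by
      field_simp
    have h3 : |max R ‖y‖ - max R ‖x‖| ≤ ‖x - y‖ := by
      refine (abs_max_sub_max_le_abs ‖y‖ ‖x‖ R |>.trans' ?_).trans ?_
      · rw [max_comm R, max_comm R]
      · rw [norm_sub_rev]; exact abs_norm_sub_norm_le y x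
    have h4 : ‖y‖ / max R ‖y‖ ≤ 1 := (div_le_one hy).2 (le_max_right _ _)
    rw [dist_eq_norm, dist_eq_norm, h1, h2]
    calc _ ≤ ‖(R / max R ‖x‖) • (x - y)‖
          + ‖(R / max R ‖x‖ * ((max R ‖y‖ - max R ‖x‖) / max R ‖y‖)) • y‖ := norm_add_le _ _
      _ = R / max R ‖x‖ * ‖x - y‖
          + R / max R ‖x‖ * (|max R ‖y‖ - max R ‖x‖| * (‖y‖ / max R ‖y‖)) := by
        rw [norm_smul, norm_smul, norm_mul, Real.norm_of_nonneg hc0, norm_div, Real.norm_eq_abs,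
          Real.norm_of_nonneg hy.le]
        ring
      _ ≤ 1 * ‖x - y‖ + 1 * (‖x - y‖ * 1) := by gcongr
      _ = _ := by push_cast; ring
  · rw [mem_closedBall_zero_iff, norm_smul, norm_div, Real.norm_of_nonneg hR.le,
      Real.norm_of_nonneg (hm x).le, div_mul_eq_mul_div, div_le_iff₀ (hm x)]
    exact mul_le_mul_of_nonneg_left (le_max_right _ _) hR.le
  · rw [mem_closedBall_zero_iff] at hx
    simp only [max_eq_left hx, div_self hR.ne', one_smul]

section Existence

variable {E : Type*} [NormedAddCommGroup E] [InnerProductSpace ℝ E] [FiniteDimensional ℝ E]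
  [MeasurableSpace E] [BorelSpace E]

/-- Global existence for a globally Lipschitz field. The Picard operator is a contraction for the
norm weighted by `exp (-2 Λ (s - a))`; the weight is absorbed in the unknown. -/
theorem IsCaratheodoryField.exists_isTrajectory_of_lipschitzWith {g : ℝ → E → E}
    (hg : IsCaratheodoryField g) {Λ : ℝ≥0} (hΛ : ∀ t, LipschitzWith Λ (g t)) {a b : ℝ}
    (hab : a ≤ b) (y : E) : ∃ x, IsTrajectory g a b x ∧ x a = y := by
  set k : ℝ := 2 * (Λ + 1) with hk
  have hk0 : 0 < k := by positivity
  set e : ℝ → ℝ := fun r => Real.exp (k * (r - a)) with he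
  have hec : Continuous e := by fun_prop
  have he0 : ∀ r, 0 < e r := fun r => Real.exp_pos _
  have hei : ∀ s, ∫ r in a..s, e r = (e s - 1) / k := fun s => by
    have hd : ∀ r ∈ uIcc a s, HasDerivAt (fun r => e r / k) (e r) r := fun r _ => by
      have h := ((((hasDerivAt_id r).sub_const a).const_mul k).exp).div_const k
      rwa [mul_one, mul_div_cancel_right₀ _ hk0.ne'] at h
    rw [intervalIntegral.integral_eq_sub_of_hasDerivAt hd (hec.intervalIntegrable _ _)]
    simp [he, sub_div]
  -- the curve represented by `z`
  let c : C(Icc a b, E) → ℝ → E := fun z r => e r • IccExtend hab z r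
  have hc : ∀ z, Continuous (c z) := fun z => hec.smul (z.continuous.Icc_extend')
  have hgi : ∀ z s, IntervalIntegrable (fun r => g r (c z r)) volume a s := fun z s => by
    rcases le_total a s with h | h
    · exact hg.intervalIntegrable h (hc z).continuousOn
    · exact (hg.intervalIntegrable h (hc z).continuousOn).symm
  have hgc : ∀ z, ContinuousOn (fun s => ∫ r in a..s, g r (c z r)) (Icc a b) := fun z => by
    have h := intervalIntegral.continuousOn_primitive_interval' (hgi z b) left_mem_uIcc
    rwa [uIcc_of_le hab] at h
  let Q : C(Icc a b, E) → C(Icc a b, E) := fun z =>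
    ⟨fun s => (e s)⁻¹ • (y + ∫ r in a..s, g r (c z r)), by
      have h : ContinuousOn (fun s : ℝ => (e s)⁻¹ • (y + ∫ r in a..s, g r (c z r))) (Icc a b) :=
        (hec.continuousOn.inv₀ fun s _ => (he0 s).ne').smul (continuousOn_const.add (hgc z))
      exact continuousOn_iff_continuous_domRestrict.1 h⟩
  have hQ : ContractingWith (1 / 2) Q := by
    refine ⟨by
      rw [← NNReal.coe_lt_coe]; norm_num, LipschitzWith.of_dist_le_mul fun z z' => ?_⟩
    rw [ContinuousMap.dist_le (by positivity)]
    rintro ⟨s, hs⟩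
    have h1 : ‖(∫ r in a..s, g r (c z r)) - ∫ r in a..s, g r (c z' r)‖
        ≤ ∫ r in a..s, (Λ * dist z z') * e r := by
      rw [← intervalIntegral.integral_sub (hgi z s) (hgi z' s)]
      refine intervalIntegral.norm_integral_le_of_norm_le hs.1 (ae_of_all _ fun r hr => ?_)
        ((hec.intervalIntegrable _ _).const_mul _)
      refine ((hΛ r).norm_sub_le _ _).trans ?_
      rw [mul_assoc]
      refine mul_le_mul_of_nonneg_left ?_ Λ.2
      rw [show c z r - c z' r = e r • (IccExtend hab z r - IccExtend hab z' r) from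
        (smul_sub _ _ _).symm, norm_smul, Real.norm_of_nonneg (he0 r).le, mul_comm]
      refine mul_le_mul_of_nonneg_right ?_ (he0 r).le
      rw [← dist_eq_norm]
      exact ContinuousMap.dist_apply_le_dist _
    rw [intervalIntegral.integral_const_mul, hei] at h1
    rw [dist_eq_norm]
    change ‖(e s)⁻¹ • (y + ∫ r in a..s, g r (c z r)) - (e s)⁻¹ • (y + ∫ r in a..s, g r (c z' r))‖
      ≤ _
    rw [← smul_sub, add_sub_add_left_eq_sub, norm_smul, norm_inv, Real.norm_of_nonneg (he0 s).le,
      inv_mul_le_iff₀ (he0 s)]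
    refine h1.trans ?_
    have h2 : (Λ : ℝ) / k ≤ 1 / 2 := by
      rw [div_le_iff₀ hk0, hk]; linarith
    have h3 : 0 ≤ dist z z' := dist_nonneg
    calc Λ * dist z z' * ((e s - 1) / k) = (Λ / k) * (dist z z' * (e s - 1)) := by ring
      _ ≤ (Λ / k) * (dist z z' * e s) := by gcongr; linarith
      _ ≤ 1 / 2 * (dist z z' * e s) :=
        mul_le_mul_of_nonneg_right h2 (mul_nonneg h3 (he0 s).le)
      _ = _ := by push_cast; ring
  obtain ⟨z, hz⟩ : ∃ z, Q z = z := ⟨_, hQ.fixedPoint_isFixedPt⟩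
  have hx : ∀ s ∈ Icc a b, c z s = y + ∫ r in a..s, g r (c z r) := fun s hs => by
    have h : (Q z) ⟨s, hs⟩ = z ⟨s, hs⟩ := by rw [hz]
    change (e s)⁻¹ • (y + ∫ r in a..s, g r (c z r)) = _ at h
    simp only [c] at h ⊢
    rw [IccExtend_of_mem hab z hs, ← h, smul_inv_smul₀ (he0 s).ne']
  have hxa : c z a = y := by simpa using hx a (left_mem_Icc.2 hab)
  exact ⟨c z, ⟨(hc z).continuousOn, fun s hs => by rw [hxa]; exact hx s hs⟩, hxa⟩

/-- Existence near a curve that nearly solves the equation; no growth condition is needed, since the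
trajectory of a truncated field stays close to the given curve. -/
theorem IsCaratheodoryField.exists_isTrajectory_near {g : ℝ → E → E}
    (hg : IsCaratheodoryField g) {a b R M c : ℝ} (hab : a ≤ b)
    {L : ℝ≥0} (hL : ∀ t, LipschitzOnWith L (g t) (Metric.closedBall 0 (R + 1))) {X w : ℝ → E}
    (hXc : ContinuousOn X (Icc a b)) (hXR : ∀ s ∈ Icc a b, ‖X s‖ ≤ R)
    (hw : IntervalIntegrable w volume a b) (hX : ∀ s ∈ Icc a b, X s = X a + ∫ r in a..s, w r)
    (hwM : ∀ r ∈ Icc a b, ‖w r - g r (X r)‖ ≤ M) (hM : 0 ≤ M) {y : E}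
    (hc : (‖y - X a‖ + M * (b - a)) * Real.exp (L * (b - a)) ≤ c) (hc1 : c < 1) :
    ∃ x, IsTrajectory g a b x ∧ x a = y := by
  have hR : 0 ≤ R := (norm_nonneg _).trans (hXR a (left_mem_Icc.2 hab))
  obtain ⟨π, hπ, hπR, hπe⟩ := exists_lipschitzWith_retraction_closedBall (E := E)
    (R := R + 1) (by linarith)
  obtain ⟨M', hM'⟩ := hg.bounded (R + 1)
  have hg' : IsCaratheodoryField fun t x => g t (π x) :=
    { measurable := by
        have h : Measurable fun q : ℝ × E => (q.1, π q.2) :=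
          measurable_fst.prodMk (hπ.continuous.measurable.comp measurable_snd)
        exact hg.measurable.comp h
      lipschitz := fun _ => ⟨L * 2, fun t =>
        ((hL t).comp hπ.lipschitzOnWith fun x _ => hπR x)⟩
      bounded := fun _ => ⟨M', fun t x _ => hM' t _ (hπR x)⟩ }
  have hglob : ∀ t, LipschitzWith (L * 2) fun x => g t (π x) := fun t => by
    rw [← lipschitzOnWith_univ]
    exact (hL t).comp hπ.lipschitzOnWith fun x _ => hπR x
  obtain ⟨x, hx, hxa⟩ := hg'.exists_isTrajectory_of_lipschitzWith hglob hab y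
  have hXmem : ∀ s ∈ Icc a b, X s ∈ Metric.closedBall (0 : E) (R + 1) := fun s hs => by
    rw [mem_closedBall_zero_iff]; linarith [hXR s hs]
  have hclose := hx.norm_sub_le hg' (L := L) (R := R) (M := M) (c := c)
    (fun t p hp q hq => by
      simp only [hπe p hp, hπe q hq]; exact hL t hp hq)
    hXc hXR hw hX (fun r hr => by rw [hπe _ (hXmem r hr)]; exact hwM r hr) hM
    (by rwa [hxa]) hc1
  have hxm : ∀ s ∈ Icc a b, π (x s) = x s := fun s hs => hπe _ <| by
    rw [mem_closedBall_zero_iff]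
    have := norm_add_le (X s) (x s - X s)
    rw [add_sub_cancel] at this
    linarith [hXR s hs, hclose s hs]
  refine ⟨x, ⟨hx.continuousOn, fun s hs => ?_⟩, hxa⟩
  rw [hx.eq_integral s hs]
  congr 1
  refine intervalIntegral.integral_congr fun r hr => ?_
  rw [uIcc_of_le hs.1] at hr
  simp only [hxm r ⟨hr.1, hr.2.trans hs.2⟩]

end Existence

/-! ### Almost everywhere differentiability of fields -/

section Differentiability

variable {E F : Type*} [NormedAddCommGroup E] [InnerProductSpace ℝ E] [FiniteDimensional ℝ E]
  [MeasurableSpace E] [BorelSpace E] [NormedAddCommGroup F] [InnerProductSpace ℝ F]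
  [FiniteDimensional ℝ F] [MeasurableSpace F] [BorelSpace F]

/-- A function that is approximated near `x` by linear maps, up to an arbitrarily small relative
error, is differentiable at `x`: the approximating linear maps form a Cauchy sequence. -/
theorem differentiableAt_of_forall_approx {E F : Type*} [NormedAddCommGroup E] [NormedSpace ℝ E]
    [NormedAddCommGroup F] [NormedSpace ℝ F] [CompleteSpace F] {φ : E → F} {x : E}
    (h : ∀ k : ℕ, ∃ (A : E →L[ℝ] F) (δ : ℝ), 0 < δ ∧
      ∀ v, ‖v‖ < δ → ‖φ (x + v) - φ x - A v‖ ≤ 1 / ((k : ℝ) + 1) * ‖v‖) :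
    DifferentiableAt ℝ φ x := by
  choose A δ hδ hA using h
  have hAA : ∀ j k, dist (A j) (A k) ≤ 1 / ((j : ℝ) + 1) + 1 / ((k : ℝ) + 1) := fun j k => by
    rw [dist_eq_norm]
    refine ContinuousLinearMap.opNorm_le_of_ball (lt_min (hδ j) (hδ k)) (by positivity)
      fun v hv => ?_
    rw [mem_ball_zero_iff] at hv
    have h1 := hA j v (hv.trans_le (min_le_left _ _))
    have h2 := hA k v (hv.trans_le (min_le_right _ _))
    rw [add_mul]
    calc ‖(A j - A k) v‖ = ‖(φ (x + v) - φ x - A k v) - (φ (x + v) - φ x - A j v)‖ := by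
          rw [sub_apply]; congr 1; abel
      _ ≤ _ := norm_sub_le _ _
      _ ≤ _ := by linarith
  have hlim := tendsto_one_div_add_atTop_nhds_zero_nat (𝕜 := ℝ)
  have hcauchy : CauchySeq A := by
    refine cauchySeq_of_le_tendsto_0 (fun n : ℕ => 2 * (1 / ((n : ℝ) + 1)))
      (fun j k n hj hk => (hAA j k).trans ?_) (by simpa using hlim.const_mul 2)
    have h1 : 1 / ((j : ℝ) + 1) ≤ 1 / ((n : ℝ) + 1) := by gcongr
    have h2 : 1 / ((k : ℝ) + 1) ≤ 1 / ((n : ℝ) + 1) := by gcongr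
    linarith
  obtain ⟨B, hB⟩ := cauchySeq_tendsto_of_complete hcauchy
  have hAB : ∀ k, ‖A k - B‖ ≤ 1 / ((k : ℝ) + 1) := fun k => by
    rw [← dist_eq_norm]
    refine le_of_tendsto_of_tendsto (tendsto_const_nhds.dist hB)
      (by simpa using tendsto_const_nhds.add hlim) (Eventually.of_forall fun j => hAA k j)
  refine ⟨B, ?_⟩
  rw [hasFDerivAt_iff_isLittleO_nhds_zero, Asymptotics.isLittleO_iff]
  intro c hc
  obtain ⟨k, hk⟩ := exists_nat_one_div_lt (half_pos hc)
  filter_upwards [Metric.ball_mem_nhds (0 : E) (hδ k)] with v hv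
  rw [mem_ball_zero_iff] at hv
  calc ‖φ (x + v) - φ x - B v‖ = ‖(φ (x + v) - φ x - A k v) + (A k - B) v‖ := by
        rw [sub_apply]; congr 1; abel
    _ ≤ _ := norm_add_le _ _
    _ ≤ 1 / ((k : ℝ) + 1) * ‖v‖ + 1 / ((k : ℝ) + 1) * ‖v‖ :=
        add_le_add (hA k v hv) ((A k - B).le_of_opNorm_le (hAB k) v)
    _ ≤ c * ‖v‖ := by nlinarith [norm_nonneg v]

theorem measurableSet_differentiableAt_of_continuous_snd {g : ℝ → E → F}
    (hg : Measurable (Function.uncurry g)) (hc : ∀ t, Continuous (g t)) :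
    MeasurableSet {z : ℝ × E | DifferentiableAt ℝ (g z.1) z.2} := by
  set D : ℕ → E := TopologicalSpace.denseSeq E
  set B : ℕ → E →L[ℝ] F := TopologicalSpace.denseSeq (E →L[ℝ] F)
  -- differentiability expressed by countably many conditions, through dense sequences of increments
  -- and of linear maps
  have heq : {z : ℝ × E | DifferentiableAt ℝ (g z.1) z.2} = ⋂ k : ℕ, ⋃ i : ℕ, ⋃ m : ℕ, ⋂ j : ℕ,
      {z : ℝ × E | ‖D j‖ < 1 / ((m : ℝ) + 1) →
        ‖g z.1 (z.2 + D j) - g z.1 z.2 - B i (D j)‖ ≤ 1 / ((k : ℝ) + 1) * ‖D j‖} := by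
    ext ⟨t, x⟩
    simp only [mem_ofPred_eq, mem_iInter, mem_iUnion]
    constructor
    · rintro ⟨A, hA⟩ k
      have hk : (0 : ℝ) < 1 / ((k : ℝ) + 1) := by positivity
      obtain ⟨i, hi⟩ : ∃ i, dist A (B i) < 1 / ((k : ℝ) + 1) / 2 :=
        (TopologicalSpace.denseRange_denseSeq (E →L[ℝ] F)).exists_dist_lt A (half_pos hk)
      rw [hasFDerivAt_iff_isLittleO_nhds_zero, Asymptotics.isLittleO_iff] at hA
      obtain ⟨δ, hδ, hball⟩ := Metric.eventually_nhds_iff_ball.1 (hA (half_pos hk))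
      obtain ⟨m, hm⟩ := exists_nat_one_div_lt hδ
      refine ⟨i, m, fun j hj => ?_⟩
      have h1 := hball (D j) (by rw [mem_ball_zero_iff]; exact hj.trans hm)
      rw [dist_eq_norm] at hi
      calc ‖g t (x + D j) - g t x - B i (D j)‖
          = ‖(g t (x + D j) - g t x - A (D j)) + (A - B i) (D j)‖ := by
            rw [sub_apply]; congr 1; abel
        _ ≤ _ := norm_add_le _ _
        _ ≤ _ := add_le_add h1 ((A - B i).le_of_opNorm_le hi.le _)
        _ = _ := by ring
    · intro h
      refine differentiableAt_of_forall_approx fun k => ?_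
      obtain ⟨i, m, hj⟩ := h k
      refine ⟨B i, 1 / ((m : ℝ) + 1), by positivity, fun v hv => ?_⟩
      have hclosed : IsClosed {v : E | ‖g t (x + v) - g t x - B i v‖ ≤ 1 / ((k : ℝ) + 1) * ‖v‖} :=
        isClosed_le (by have := hc t; fun_prop) (by fun_prop)
      have hsub : Metric.ball (0 : E) (1 / ((m : ℝ) + 1)) ∩ range D ⊆
          {v : E | ‖g t (x + v) - g t x - B i v‖ ≤ 1 / ((k : ℝ) + 1) * ‖v‖} := by
        rintro _ ⟨hv, j, rfl⟩
        exact hj j (by simpa using hv)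
      exact closure_minimal hsub hclosed
        ((TopologicalSpace.denseRange_denseSeq E).open_subset_closure_inter Metric.isOpen_ball
          (by simpa using hv))
  rw [heq]
  refine MeasurableSet.iInter fun k => MeasurableSet.iUnion fun i => MeasurableSet.iUnion fun m =>
    MeasurableSet.iInter fun j => ?_
  by_cases hj : ‖D j‖ < 1 / ((m : ℝ) + 1)
  · simp only [hj, true_imp_iff]
    refine measurableSet_le ?_ measurable_const
    have h1 : Measurable fun z : ℝ × E => g z.1 (z.2 + D j) :=
      hg.comp (measurable_fst.prodMk (measurable_snd.add_const _))
    exact ((h1.sub hg).sub_const _).norm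
  · simp only [hj, false_imp_iff]
    exact MeasurableSet.univ

theorem IsCaratheodoryField.continuous {g : ℝ → E → F} (hg : IsCaratheodoryField g) (t : ℝ) :
    Continuous (g t) := by
  refine continuous_iff_continuousAt.2 fun x => ?_
  obtain ⟨L, hL⟩ := hg.lipschitz (‖x‖ + 1)
  exact (hL t).continuousOn.continuousAt
    (Metric.closedBall_mem_nhds_of_mem (by rw [mem_ball_zero_iff]; linarith))

/-- Rademacher's theorem for functions that are Lipschitz on balls. -/
theorem ae_differentiableAt_of_lipschitzOnWith_closedBall {E F : Type*} [NormedAddCommGroup E]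
    [NormedSpace ℝ E] [FiniteDimensional ℝ E] [MeasurableSpace E] [BorelSpace E]
    [NormedAddCommGroup F] [NormedSpace ℝ F] [FiniteDimensional ℝ F]
    (μ : Measure E) [μ.IsAddHaarMeasure]
    {φ : E → F} (h : ∀ R : ℝ, ∃ L : ℝ≥0, LipschitzOnWith L φ (Metric.closedBall 0 R)) :
    ∀ᵐ x ∂μ, DifferentiableAt ℝ φ x := by
  have h1 : ∀ n : ℕ, ∀ᵐ x ∂μ, x ∈ Metric.closedBall (0 : E) n →
      DifferentiableWithinAt ℝ φ (Metric.closedBall 0 n) x := fun n => by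
    obtain ⟨L, hL⟩ := h n
    exact hL.ae_differentiableWithinAt_of_mem
  filter_upwards [ae_all_iff.2 h1] with x hx
  obtain ⟨n, hn⟩ := exists_nat_gt ‖x‖
  exact (hx n (by simpa using hn.le)).differentiableAt
    (Metric.closedBall_mem_nhds_of_mem (by simpa using hn))

theorem IsCaratheodoryField.ae_differentiableAt {g : ℝ → E → F} (hg : IsCaratheodoryField g)
    (μ : Measure E) [μ.IsAddHaarMeasure] :
    ∀ᵐ z ∂(volume.prod μ : Measure (ℝ × E)), DifferentiableAt ℝ (g z.1) z.2 := by
  -- Fubini's theorem needs the exceptional set to be measurable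
  have hm := measurableSet_differentiableAt_of_continuous_snd hg.measurable hg.continuous
  refine (Measure.measure_prod_null hm.compl).2 (ae_of_all _ fun t => ?_)
  exact ae_differentiableAt_of_lipschitzOnWith_closedBall μ fun R =>
    (hg.lipschitz R).imp fun L hL => hL t

end Differentiability

/-! ### The flow of a Carathéodory field -/

section Flow

variable {E : Type*} [NormedAddCommGroup E] [InnerProductSpace ℝ E] [FiniteDimensional ℝ E]
  [MeasurableSpace E] [BorelSpace E]

/-- `Φ y` is a trajectory of `g` on `[t, T]` that starts from `y` at time `t`. -/
def IsFlowFrom (g : ℝ → E → E) (t T : ℝ) (Φ : E → ℝ → E) : Prop :=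
  ∀ y, IsTrajectory g t T (Φ y) ∧ Φ y t = y

/-- Locally in the initial point, the flow is bounded, and bi-Lipschitz in the initial point. -/
theorem IsFlowFrom.exists_ball {g : ℝ → E → E} (hg : IsCaratheodoryField g) {t T : ℝ}
    {Φ : E → ℝ → E} (hΦ : IsFlowFrom g t T Φ) (htT : t ≤ T) (y₀ : E) :
    ∃ ρ > 0, ∃ (R : ℝ) (C : ℝ≥0), (∀ y ∈ Metric.ball y₀ ρ, ∀ s ∈ Icc t T, ‖Φ y s‖ ≤ R) ∧
      ∀ y ∈ Metric.ball y₀ ρ, ∀ y' ∈ Metric.ball y₀ ρ, ∀ s ∈ Icc t T,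
        ‖Φ y s - Φ y' s‖ ≤ C * ‖y - y'‖ ∧ ‖y - y'‖ ≤ C * ‖Φ y s - Φ y' s‖ := by
  obtain ⟨R₀, hR₀, hR₀b⟩ := (hΦ y₀).1.continuousOn.exists_norm_le_Icc
  set R := R₀ + 1 with hR
  obtain ⟨L, hL⟩ := hg.lipschitz (R + 1)
  set c := Real.exp (L * (T - t)) with hc
  have hc1 : 1 ≤ c := Real.one_le_exp (mul_nonneg L.2 (sub_nonneg.2 htT))
  have hc0 : 0 < c := by linarith
  have hmono : ∀ {R' R'' : ℝ}, R' ≤ R'' → Metric.closedBall (0 : E) R' ⊆ Metric.closedBall 0 R'' :=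
    fun h => Metric.closedBall_subset_closedBall h
  have hstab : ∀ {R' : ℝ}, R' ≤ R → ∀ y y', (∀ s ∈ Icc t T, ‖Φ y' s‖ ≤ R') →
      ‖y - y'‖ * c < 1 → ∀ s ∈ Icc t T, ‖Φ y s - Φ y' s‖ ≤ ‖y - y'‖ * c := by
    intro R' hR' y y' hb h1
    refine (hΦ y).1.norm_sub_le hg (M := 0) (R := R')
      (fun t => (hL t).mono (hmono (by linarith)))
      (hΦ y').1.continuousOn hb (hg.intervalIntegrable htT (hΦ y').1.continuousOn)
      (hΦ y').1.eq_integral (by simp) le_rfl ?_ h1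
    rw [(hΦ y).2, (hΦ y').2, zero_mul, add_zero]
  have hbound : ∀ y ∈ Metric.ball y₀ (1 / (4 * c)), ∀ s ∈ Icc t T, ‖Φ y s‖ ≤ R := by
    intro y hy s hs
    rw [mem_ball_iff_norm, lt_div_iff₀ (by positivity)] at hy
    have h1 := hstab (by linarith) y y₀ hR₀b (by nlinarith) s hs
    have h2 := norm_add_le (Φ y₀ s) (Φ y s - Φ y₀ s)
    rw [add_sub_cancel] at h2
    have := hR₀b s hs
    nlinarith
  refine ⟨1 / (4 * c), by positivity, R, ⟨c, hc0.le⟩, hbound, fun y hy y' hy' s hs => ⟨?_, ?_⟩⟩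
  · rw [mul_comm]
    refine hstab le_rfl y y' (hbound y' hy') ?_ s hs
    have h1 : ‖y - y'‖ ≤ ‖y - y₀‖ + ‖y' - y₀‖ := by
      rw [norm_sub_rev y' y₀]; exact norm_sub_le_norm_sub_add_norm_sub _ _ _
    rw [mem_ball_iff_norm, lt_div_iff₀ (by positivity)] at hy hy'
    nlinarith
  · have hsub : Icc t s ⊆ Icc t T := Icc_subset_Icc_right hs.2
    have h1 := ((hΦ y).1.mono hg le_rfl hs.2).norm_sub_le_right hg (R := R) (L := L)
      (fun t => (hL t).mono (hmono (by linarith)))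
      ((hΦ y').1.mono hg le_rfl hs.2) (fun r hr => hbound y hy r (hsub hr))
      (fun r hr => hbound y' hy' r (hsub hr)) hs.1
    rw [(hΦ y).2, (hΦ y').2, mul_comm] at h1
    refine h1.trans (mul_le_mul_of_nonneg_right ?_ (norm_nonneg _))
    exact Real.exp_le_exp.2 (mul_le_mul_of_nonneg_left (by linarith [hs.2]) L.2)

theorem IsFlowFrom.continuous {g : ℝ → E → E} (hg : IsCaratheodoryField g) {t T : ℝ}
    {Φ : E → ℝ → E} (hΦ : IsFlowFrom g t T Φ) {s : ℝ} (hs : s ∈ Icc t T) :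
    Continuous fun y => Φ y s := by
  refine continuous_iff_continuousAt.2 fun y₀ => ?_
  obtain ⟨ρ, hρ, R, C, -, h⟩ := hΦ.exists_ball hg (hs.1.trans hs.2) y₀
  have hlip : LipschitzOnWith C (fun y => Φ y s) (Metric.ball y₀ ρ) :=
    LipschitzOnWith.of_dist_le_mul fun y hy y' hy' => by
      rw [dist_eq_norm, dist_eq_norm]; exact (h y hy y' hy' s hs).1
  exact hlip.continuousOn.continuousAt (Metric.ball_mem_nhds y₀ hρ)

/-- The inverse of the flow is locally Lipschitz, so preimages of null sets are null. -/
theorem IsFlowFrom.measure_preimage_eq_zero {g : ℝ → E → E} (hg : IsCaratheodoryField g) {t T : ℝ}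
    {Φ : E → ℝ → E} (hΦ : IsFlowFrom g t T Φ) {s : ℝ} (hs : s ∈ Icc t T) (μ : Measure E)
    [μ.IsAddHaarMeasure] {Z : Set E} (hZ : μ Z = 0) : μ {y | Φ y s ∈ Z} = 0 := by
  set d : ℝ := (Module.finrank ℝ E : ℝ) with hd
  have hd0 : 0 ≤ d := Nat.cast_nonneg _
  have hμH : μ.AbsolutelyContinuous (μH[d] : Measure E) :=
    Measure.absolutelyContinuous_isAddHaarMeasure _ _
  have hHμ : (μH[d] : Measure E).AbsolutelyContinuous μ :=
    Measure.absolutelyContinuous_isAddHaarMeasure _ _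
  have hZH := hHμ hZ
  refine hμH (measure_null_of_locally_null _ fun y₀ _ => ?_)
  obtain ⟨ρ, hρ, R, C, -, h⟩ := hΦ.exists_ball hg (hs.1.trans hs.2) y₀
  refine ⟨{y | Φ y s ∈ Z} ∩ Metric.ball y₀ ρ,
    inter_mem_nhdsWithin _ (Metric.ball_mem_nhds y₀ hρ), ?_⟩
  have hanti : AntilipschitzWith C fun y : Metric.ball y₀ ρ => Φ y s :=
    AntilipschitzWith.of_le_mul_dist fun y y' => by
      rw [Subtype.dist_eq, dist_eq_norm, dist_eq_norm]
      exact (h y y.2 y' y'.2 s hs).2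
  have h1 := hanti.hausdorffMeasure_preimage_le hd0 Z
  rw [hZH, mul_zero, nonpos_iff_eq_zero] at h1
  have h2 := (isometry_subtype_coe (s := Metric.ball y₀ ρ)).hausdorffMeasure_image
    (Or.inl hd0) ((fun y : Metric.ball y₀ ρ => Φ y s) ⁻¹' Z)
  rw [h1] at h2
  refine measure_mono_null ?_ h2
  rintro y ⟨hy, hyb⟩
  exact ⟨⟨y, hyb⟩, hy, rfl⟩

/-- Along the trajectory from almost every initial point, a property that holds for almost every
`(r, x)` holds at almost every time. -/
theorem IsFlowFrom.ae_ae {g : ℝ → E → E} (hg : IsCaratheodoryField g) {t T : ℝ}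
    {Φ : E → ℝ → E} (hΦ : IsFlowFrom g t T Φ) (htT : t ≤ T) (μ : Measure E) [μ.IsAddHaarMeasure]
    {P : ℝ × E → Prop} (hP : ∀ᵐ z ∂(volume.prod μ : Measure (ℝ × E)), P z) :
    ∀ᵐ y ∂μ, ∀ᵐ r, r ∈ Icc t T → P (r, Φ y r) := by
  set Z := toMeasurable (volume.prod μ : Measure (ℝ × E)) {z | ¬ P z} with hZ
  have hZm : MeasurableSet Z := measurableSet_toMeasurable _ _
  have hZ0 : (volume.prod μ : Measure (ℝ × E)) Z = 0 := by
    rw [hZ, measure_toMeasurable]; exact hP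
  have hZP : ∀ z, z ∉ Z → P z := fun z hz => by
    by_contra hn; exact hz (subset_toMeasurable _ _ hn)
  set Φ' : E → ℝ → E := fun y r => Φ y (projIcc t T htT r) with hΦ'
  have hΦ'e : ∀ y, ∀ r ∈ Icc t T, Φ' y r = Φ y r := fun y r hr => by
    rw [hΦ']; simp only; rw [projIcc_of_mem htT hr]
  have hΦm : Measurable (Function.uncurry Φ') := by
    refine measurable_uncurry_of_continuous_of_measurable (fun r => ?_) fun y => ?_
    · exact hΦ.continuous hg (projIcc t T htT r).2
    · exact (((continuousOn_iff_continuous_domRestrict.1 (hΦ y).1.continuousOn).comp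
        continuous_projIcc)).measurable
  set S : Set (ℝ × E) := {z | z.1 ∈ Icc t T ∧ (z.1, Φ' z.2 z.1) ∈ Z} with hS
  have hSm : MeasurableSet S := by
    refine (measurable_fst measurableSet_Icc).inter ?_
    exact (measurable_fst.prodMk (hΦm.comp measurable_swap)) hZm
  have h1 : ∀ᵐ r, ∀ᵐ y ∂μ, (r, y) ∈ Sᶜ := by
    filter_upwards [(Measure.measure_prod_null hZm).1 hZ0] with r hr
    by_cases hrI : r ∈ Icc t T
    · have := hΦ.measure_preimage_eq_zero hg hrI μ hr
      refine measure_mono_null (fun y hy => ?_) this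
      have hy : (r, y) ∈ S := by simpa using hy
      have hy2 : (r, Φ' y r) ∈ Z := hy.2
      rw [hΦ'e y r hrI] at hy2
      exact hy2
    · exact ae_of_all _ fun y hy => hrI hy.1
  have h2 : ∀ᵐ y ∂μ, ∀ᵐ r, (r, y) ∈ Sᶜ :=
    (Measure.ae_ae_comm (p := fun r y => (r, y) ∈ Sᶜ) hSm.compl).1 h1
  filter_upwards [h2] with y hy
  filter_upwards [hy] with r hr hrI
  refine hZP _ fun hz => hr ⟨hrI, ?_⟩
  simpa only [hΦ'e y r hrI] using hz

end Flow

/-! ### Locally Lipschitz functions with an almost everywhere continuous gradient -/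

/-- A property that holds almost everywhere holds at almost every point of almost every parallel
translate of a given line. -/
theorem ae_ae_line {E : Type*} [NormedAddCommGroup E] [NormedSpace ℝ E] [FiniteDimensional ℝ E]
    [MeasurableSpace E] [BorelSpace E] (μ : Measure E) [μ.IsAddHaarMeasure] {P : E → Prop}
    (hP : ∀ᵐ y ∂μ, P y) (y v : E) : ∀ᵐ z ∂μ, ∀ᵐ θ : ℝ, P (y + θ • v + z) := by
  set Z := toMeasurable μ {y | ¬ P y} with hZ
  have hZm : MeasurableSet Z := measurableSet_toMeasurable _ _
  have hZ0 : μ Z = 0 := by rw [hZ, measure_toMeasurable]; exact hP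
  have h1 : ∀ᵐ θ : ℝ, ∀ᵐ z ∂μ, (θ, z) ∈ {q : ℝ × E | y + q.1 • v + q.2 ∈ Zᶜ} :=
    ae_of_all _ fun θ => by
      have h : μ ((fun z => y + θ • v + z) ⁻¹' Z) = 0 := by rw [measure_preimage_add, hZ0]
      exact measure_mono_null (fun z hz => by simpa using hz) h
  have hm : MeasurableSet {q : ℝ × E | y + q.1 • v + q.2 ∈ Zᶜ} := by
    have hc : Continuous fun q : ℝ × E => y + q.1 • v + q.2 := by fun_prop
    exact hc.measurable hZm.compl
  have h2 := (Measure.ae_ae_comm (p := fun θ z => (θ, z) ∈ {q : ℝ × E | y + q.1 • v + q.2 ∈ Zᶜ})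
    hm).1 h1
  filter_upwards [h2] with z hz
  filter_upwards [hz] with θ hθ
  by_contra hn
  exact hθ (subset_toMeasurable _ _ hn)

/-- If the derivative of a locally Lipschitz function coincides almost everywhere with a continuous
function, then it does so everywhere. -/
theorem hasFDerivAt_of_ae_hasFDerivAt {E : Type*} [NormedAddCommGroup E] [NormedSpace ℝ E]
    [FiniteDimensional ℝ E] [MeasurableSpace E] [BorelSpace E] (μ : Measure E)
    [μ.IsAddHaarMeasure] {W : E → ℝ} {A : E → E →L[ℝ] ℝ} (hA : Continuous A)
    (hW : ∀ y, ∃ ρ > 0, ∃ C : ℝ≥0, LipschitzOnWith C W (Metric.ball y ρ))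
    (h : ∀ᵐ y ∂μ, HasFDerivAt W (A y) y) (y₀ : E) : HasFDerivAt W (A y₀) y₀ := by
  refine HasStrictFDerivAt.hasFDerivAt (.of_isLittleO ?_)
  rw [Asymptotics.isLittleO_iff]
  intro ε hε
  obtain ⟨ρ, hρ, C, hC⟩ := hW y₀
  obtain ⟨κ, hκ, hAκ⟩ := Metric.continuousAt_iff.1 hA.continuousAt ε hε
  set η := min ρ κ / 2 with hη
  have hη0 : 0 < η := half_pos (lt_min hρ hκ)
  have h2ρ : 2 * η ≤ ρ := by rw [hη]; linarith [min_le_left ρ κ]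
  have h2κ : 2 * η ≤ κ := by rw [hη]; linarith [min_le_right ρ κ]
  filter_upwards [prod_mem_nhds (Metric.ball_mem_nhds y₀ hη0) (Metric.ball_mem_nhds y₀ hη0)]
  rintro ⟨y', y⟩ ⟨hy', hy⟩
  simp only at hy hy' ⊢
  set v := y' - y with hv
  have hline : ∀ z ∈ Metric.ball (0 : E) η, ∀ θ ∈ Icc (0 : ℝ) 1,
      y + θ • v + z ∈ Metric.ball y₀ (2 * η) := by
    intro z hz θ hθ
    have h1 : y + θ • v ∈ Metric.ball y₀ η := by
      have := (convex_ball y₀ η).add_smul_sub_mem hy hy' hθ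
      simpa [hv] using this
    rw [mem_ball_zero_iff] at hz
    rw [mem_ball_iff_norm] at h1 ⊢
    calc ‖y + θ • v + z - y₀‖ = ‖(y + θ • v - y₀) + z‖ := by congr 1; abel
      _ ≤ _ := norm_add_le _ _
      _ < 2 * η := by linarith
  -- the estimate on almost every line parallel to `v`
  have hae : ∀ᵐ z ∂μ, z ∈ Metric.ball (0 : E) η →
      ‖W (y' + z) - W (y + z) - A y₀ v‖ ≤ ε * ‖v‖ := by
    filter_upwards [ae_ae_line μ h y v] with z hz hzη
    set l : ℝ → ℝ := fun θ => W (y + θ • v + z) - θ * A y₀ v with hl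
    have hlip1 : LipschitzOnWith (C * ‖v‖₊) (fun θ : ℝ => W (y + θ • v + z)) (uIcc 0 1) := by
      refine LipschitzOnWith.of_dist_le_mul fun θ hθ θ' hθ' => ?_
      rw [uIcc_of_le zero_le_one] at hθ hθ'
      have hb := Metric.ball_subset_ball (x := y₀) h2ρ
      refine (hC.dist_le_mul _ (hb (hline z hzη θ hθ)) _ (hb (hline z hzη θ' hθ'))).trans ?_
      rw [dist_eq_norm, dist_eq_norm, NNReal.coe_mul, mul_assoc,
        show y + θ • v + z - (y + θ' • v + z) = (θ - θ') • v by rw [sub_smul]; abel, norm_smul,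
        coe_nnnorm, mul_comm ‖θ - θ'‖]
    have hlip2 : LipschitzOnWith ‖A y₀ v‖₊ (fun θ : ℝ => θ * A y₀ v) (uIcc 0 1) := by
      refine LipschitzOnWith.of_dist_le_mul fun θ _ θ' _ => ?_
      rw [dist_eq_norm, dist_eq_norm, ← sub_mul, norm_mul, mul_comm, coe_nnnorm]
    have hac : AbsolutelyContinuousOnInterval l 0 1 :=
      hlip1.absolutelyContinuousOnInterval.sub hlip2.absolutelyContinuousOnInterval
    have hint := hac.integral_deriv_eq_sub
    have hbd : ‖∫ θ in (0 : ℝ)..1, deriv l θ‖ ≤ ε * ‖v‖ * |1 - 0| := by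
      refine intervalIntegral.norm_integral_le_of_norm_le_const_ae ?_
      filter_upwards [hz] with θ hθ hθ1
      rw [uIoc_of_le zero_le_one] at hθ1
      have hpath : HasDerivAt (fun θ : ℝ => y + θ • v + z) v θ := by
        simpa using (((hasDerivAt_id θ).smul_const v).const_add y).add_const z
      have hd : HasDerivAt l (A (y + θ • v + z) v - 1 * A y₀ v) θ :=
        (hθ.comp_hasDerivAt θ hpath).sub ((hasDerivAt_id θ).mul_const _)
      rw [hd.deriv, one_mul, ← sub_apply]
      refine (ContinuousLinearMap.le_of_opNorm_le _ ?_ v)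
      rw [← dist_eq_norm]
      exact (hAκ ((hline z hzη θ ⟨hθ1.1.le, hθ1.2⟩).trans_le h2κ)).le
    rw [hint] at hbd
    simp only [hl, one_smul, one_mul, zero_smul, zero_mul, add_zero, sub_zero, abs_one,
      mul_one] at hbd
    rw [show y + v = y' by rw [hv]; abel] at hbd
    convert hbd using 2
    abel
  have hdense : Dense {z | z ∈ Metric.ball (0 : E) η →
      ‖W (y' + z) - W (y + z) - A y₀ v‖ ≤ ε * ‖v‖} := Measure.dense_of_ae hae
  have hfreq : ∃ᶠ z in 𝓝 (0 : E), ‖W (y' + z) - W (y + z) - A y₀ v‖ ≤ ε * ‖v‖ :=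
    ((mem_closure_iff_frequently.1 (hdense 0)).and_eventually
      (Metric.ball_mem_nhds (0 : E) hη0)).mono fun z hz => hz.1 hz.2
  have hcont : ∀ q ∈ Metric.ball y₀ η, Tendsto (fun z => W (q + z)) (𝓝 0) (𝓝 (W q)) := by
    intro q hq
    have h1 : ContinuousAt W q := hC.continuousOn.continuousAt
      (Metric.isOpen_ball.mem_nhds (Metric.ball_subset_ball (by linarith) hq))
    refine h1.tendsto.comp ?_
    have : Tendsto (fun z : E => q + z) (𝓝 0) (𝓝 (q + 0)) := tendsto_const_nhds.add tendsto_id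
    simpa using this
  exact le_of_tendsto_of_frequently
    (((hcont y' hy').sub (hcont y hy)).sub_const _).norm hfreq

/-! ### The value of a field and its gradient -/

section Value

variable {E : Type*} [NormedAddCommGroup E] [InnerProductSpace ℝ E] [FiniteDimensional ℝ E]
  [MeasurableSpace E] [BorelSpace E]

theorem IsTrajectory.ae_hasDerivAt {g : ℝ → E → E} (hg : IsCaratheodoryField g) {a b : ℝ}
    {x : ℝ → E} (hx : IsTrajectory g a b x) (hab : a ≤ b) :
    ∀ᵐ r, r ∈ Ioo a b → HasDerivAt x (g r (x r)) r := by
  filter_upwards [(hg.intervalIntegrable hab hx.continuousOn).ae_hasDerivAt_integral] with r hr hrI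
  have h1 := (hr (by rw [uIcc_of_le hab]; exact Ioo_subset_Icc_self hrI) a left_mem_uIcc).const_add
    (x a)
  refine h1.congr_of_eventuallyEq ?_
  filter_upwards [Ioo_mem_nhds hrI.1 hrI.2] with s hs
  exact hx.eq_integral s (Ioo_subset_Icc_self hs)

/-- A costate, for abstract fields: a locally Lipschitz solution of the adjoint transport system of
the state field `g` with source the gradient of the running cost `G`. -/
structure IsAdjointState (g : ℝ → E → E) (G : ℝ → E → ℝ) (T : ℝ) (μ : Measure E)
    (p : ℝ → E → E) : Prop where
  locallyLipschitz : LocallyLipschitzOn (Icc 0 T ×ˢ univ) (Function.uncurry p)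
  transport : ∀ᵐ z ∂(volume.prod μ : Measure (ℝ × E)), z.1 ∈ Ioo 0 T →
    deriv (fun s => p s z.2) z.1 + fderiv ℝ (p z.1) z.2 (g z.1 z.2)
      + ContinuousLinearMap.adjoint (fderiv ℝ (g z.1) z.2) (p z.1 z.2) = gradient (G z.1) z.2
  terminal : ∀ x, p T x = 0

theorem IsAdjointState.exists_lipschitzOnWith {g : ℝ → E → E} {G : ℝ → E → ℝ} {T : ℝ}
    {μ : Measure E} {p : ℝ → E → E} (hp : IsAdjointState g G T μ p) (R : ℝ) :
    ∃ C : ℝ≥0, LipschitzOnWith C (Function.uncurry p) (Icc 0 T ×ˢ Metric.closedBall 0 R) :=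
  (hp.locallyLipschitz.mono (prod_mono_right (subset_univ _))).exists_lipschitzOnWith_of_compact
    (isCompact_Icc.prod (isCompact_closedBall _ _))

theorem IsAdjointState.ae_differentiableAt {g : ℝ → E → E} {G : ℝ → E → ℝ} {T : ℝ}
    {μ : Measure E} [μ.IsAddHaarMeasure] {p : ℝ → E → E} (hp : IsAdjointState g G T μ p) :
    ∀ᵐ z ∂(volume.prod μ : Measure (ℝ × E)), z.1 ∈ Ioo 0 T →
      DifferentiableAt ℝ (Function.uncurry p) z := by
  have h1 : ∀ n : ℕ, ∀ᵐ z ∂(volume.prod μ : Measure (ℝ × E)),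
      z ∈ Icc 0 T ×ˢ Metric.closedBall (0 : E) n → DifferentiableWithinAt ℝ (Function.uncurry p)
        (Icc 0 T ×ˢ Metric.closedBall (0 : E) n) z := fun n => by
    obtain ⟨C, hC⟩ := hp.exists_lipschitzOnWith n
    exact hC.ae_differentiableWithinAt_of_mem
  filter_upwards [ae_all_iff.2 h1] with z hz hz1
  obtain ⟨n, hn⟩ := exists_nat_gt ‖z.2‖
  exact (hz n ⟨Ioo_subset_Icc_self hz1, by simpa using hn.le⟩).differentiableAt
    (prod_mem_nhds (Icc_mem_nhds hz1.1 hz1.2)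
      (Metric.closedBall_mem_nhds_of_mem (by simpa using hn)))

theorem IsAdjointState.continuous {g : ℝ → E → E} {G : ℝ → E → ℝ} {T : ℝ}
    {μ : Measure E} {p : ℝ → E → E} (hp : IsAdjointState g G T μ p) {t : ℝ} (ht : t ∈ Icc 0 T) :
    Continuous (p t) := by
  have h := hp.locallyLipschitz.continuousOn.comp_continuous (f := fun x : E => (t, x))
    (by fun_prop) fun x => ⟨ht, mem_univ _⟩
  exact h

/-- The derivative of a costate along a trajectory, read off from the transport system. -/
theorem IsAdjointState.hasDerivAt_inner {g : ℝ → E → E} {G : ℝ → E → ℝ} {p : ℝ → E → E}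
    {x δ : ℝ → E} {δ' : E} {r : ℝ} (hpd : DifferentiableAt ℝ (Function.uncurry p) (r, x r))
    (htr : deriv (fun s => p s (x r)) r + fderiv ℝ (p r) (x r) (g r (x r))
      + ContinuousLinearMap.adjoint (fderiv ℝ (g r) (x r)) (p r (x r)) = gradient (G r) (x r))
    (hx : HasDerivAt x (g r (x r)) r) (hδ : HasDerivAt δ δ' r) :
    HasDerivAt (fun s => inner ℝ (p s (x s)) (δ s))
      (fderiv ℝ (G r) (x r) (δ r) - inner ℝ (p r (x r)) (fderiv ℝ (g r) (x r) (δ r))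
        + inner ℝ (p r (x r)) δ') r := by
  have h1 : HasDerivAt (fun s => p s (x s))
      (fderiv ℝ (Function.uncurry p) (r, x r) (1, g r (x r))) r :=
    hpd.hasFDerivAt.comp_hasDerivAt (f := fun s => (s, x s)) r ((hasDerivAt_id r).prodMk hx)
  have h2 : HasDerivAt (fun s => p s (x r)) (fderiv ℝ (Function.uncurry p) (r, x r) (1, 0)) r :=
    hpd.hasFDerivAt.comp_hasDerivAt (f := fun s => (s, x r)) r
      ((hasDerivAt_id r).prodMk (hasDerivAt_const r _))
  have h3 : HasFDerivAt (p r) ((fderiv ℝ (Function.uncurry p) (r, x r)).comp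
      (ContinuousLinearMap.inr ℝ ℝ E)) (x r) :=
    hpd.hasFDerivAt.comp (f := fun z : E => (r, z)) (x r) (hasFDerivAt_prodMk_right r (x r))
  have h4 : fderiv ℝ (Function.uncurry p) (r, x r) (1, g r (x r))
      = gradient (G r) (x r)
        - ContinuousLinearMap.adjoint (fderiv ℝ (g r) (x r)) (p r (x r)) := by
    rw [← htr, h2.deriv, h3.fderiv, add_sub_cancel_right, ContinuousLinearMap.comp_apply,
      ContinuousLinearMap.inr_apply, ← map_add]
    simp
  have h5 : inner ℝ (gradient (G r) (x r)) (δ r) = fderiv ℝ (G r) (x r) (δ r) := by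
    rw [gradient, InnerProductSpace.toDual_symm_apply]
  have h6 := h1.inner ℝ hδ
  rw [h4, inner_sub_left, ContinuousLinearMap.adjoint_inner_left, h5] at h6
  exact h6.congr_deriv (by ring)

theorem IsFlowFrom.exists_ball_lipschitzOnWith_value {g : ℝ → E → E}
    (hg : IsCaratheodoryField g) {G : ℝ → E → ℝ} (hG : IsCaratheodoryField G) {t T : ℝ}
    {Φ : E → ℝ → E} (hΦ : IsFlowFrom g t T Φ) (htT : t ≤ T) (y₀ : E) :
    ∃ ρ > 0, ∃ C : ℝ≥0,
      LipschitzOnWith C (fun y => ∫ r in t..T, G r (Φ y r)) (Metric.ball y₀ ρ) := by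
  obtain ⟨ρ, hρ, R, C, hR, hC⟩ := hΦ.exists_ball hg htT y₀
  obtain ⟨L, hL⟩ := hG.lipschitz R
  refine ⟨ρ, hρ, (L * C) * (T - t).toNNReal, LipschitzOnWith.of_dist_le_mul fun y hy y' hy' => ?_⟩
  rw [dist_eq_norm, ← intervalIntegral.integral_sub
    (hG.intervalIntegrable htT (hΦ y).1.continuousOn)
    (hG.intervalIntegrable htT (hΦ y').1.continuousOn)]
  have h := intervalIntegral.norm_integral_le_of_norm_le_const
    (f := fun r => G r (Φ y r) - G r (Φ y' r)) (a := t) (b := T) (C := L * (C * ‖y - y'‖))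
    fun r hr => by
      rw [uIoc_of_le htT] at hr
      have hr' := Ioc_subset_Icc_self hr
      refine ((hL r).norm_sub_le (by simpa using hR y hy r hr')
        (by simpa using hR y' hy' r hr')).trans ?_
      exact mul_le_mul_of_nonneg_left (hC y hy y' hy' r hr').1 L.2
  refine h.trans (le_of_eq ?_)
  rw [abs_of_nonneg (sub_nonneg.2 htT), dist_eq_norm]
  push_cast
  rw [Real.coe_toNNReal _ (sub_nonneg.2 htT)]
  ring

/-- For almost every initial point, the value is differentiable with gradient `-p`. The increment of
the value is compared with the derivative of `⟪p, δ⟫`, where `δ` is the increment of the trajectory;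
the remainder is `o(δ)` at almost every time. -/
theorem IsAdjointState.ae_hasFDerivAt_value {g : ℝ → E → E} {G : ℝ → E → ℝ} {T : ℝ}
    {μ : Measure E} [μ.IsAddHaarMeasure] {p : ℝ → E → E} (hp : IsAdjointState g G T μ p)
    (hg : IsCaratheodoryField g) (hG : IsCaratheodoryField G) {t : ℝ} (ht : t ∈ Icc 0 T)
    {Φ : E → ℝ → E} (hΦ : IsFlowFrom g t T Φ) :
    ∀ᵐ y ∂μ, HasFDerivAt (fun y => ∫ r in t..T, G r (Φ y r)) (-(innerSL ℝ (p t y))) y := by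
  have htT := ht.2
  have hgood := ((hp.ae_differentiableAt.and hp.transport).and
    ((hg.ae_differentiableAt μ).and (hG.ae_differentiableAt μ)))
  filter_upwards [hΦ.ae_ae hg htT μ hgood] with y hy
  set x := Φ y with hx
  have hxt : x t = y := (hΦ y).2
  have hxT := (hΦ y).1
  obtain ⟨ρ, hρ, R, C, hR, hC⟩ := hΦ.exists_ball hg htT y
  have hyb : y ∈ Metric.ball y ρ := Metric.mem_ball_self hρ
  obtain ⟨Lg, hLg⟩ := hg.lipschitz (R + 1)
  obtain ⟨LG, hLG⟩ := hG.lipschitz (R + 1)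
  obtain ⟨Cp, hCp⟩ := hp.exists_lipschitzOnWith R
  obtain ⟨Cx, hCx⟩ := hxT.lipschitzOnWith hg
  set q : ℝ → E := fun r => p r (x r) with hq
  have hmaps : MapsTo (fun r => (r, x r)) (Icc t T) (Icc 0 T ×ˢ Metric.closedBall 0 R) :=
    fun r hr => ⟨⟨ht.1.trans hr.1, hr.2⟩, by simpa using hR y hyb r hr⟩
  have hqlip : LipschitzOnWith (Cp * max 1 Cx) q (Icc t T) :=
    hCp.comp ((LipschitzWith.id.lipschitzOnWith).prodMk hCx) hmaps
  obtain ⟨Q, hQ0, hQ⟩ := hqlip.continuousOn.exists_norm_le_Icc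
  lift Q to ℝ≥0 using hQ0
  -- the remainder of first order of `G - ⟪p, g⟫` along the trajectory
  set ω : E → ℝ → ℝ := fun y' r =>
    (G r (Φ y' r) - G r (x r) - fderiv ℝ (G r) (x r) (Φ y' r - x r))
      - inner ℝ (q r) (g r (Φ y' r) - g r (x r) - fderiv ℝ (g r) (x r) (Φ y' r - x r)) with hω
  have hgoodr : ∀ᵐ r, r ∈ Ioo t T → HasDerivAt x (g r (x r)) r ∧
      DifferentiableAt ℝ (Function.uncurry p) (r, x r) ∧
      (deriv (fun s => p s (x r)) r + fderiv ℝ (p r) (x r) (g r (x r))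
        + ContinuousLinearMap.adjoint (fderiv ℝ (g r) (x r)) (p r (x r)) = gradient (G r) (x r)) ∧
      DifferentiableAt ℝ (g r) (x r) ∧ DifferentiableAt ℝ (G r) (x r) := by
    filter_upwards [hy, hxT.ae_hasDerivAt hg htT] with r hr hr' hrI
    have hr0 : r ∈ Ioo 0 T := ⟨ht.1.trans_lt hrI.1, hrI.2⟩
    obtain ⟨⟨h1, h2⟩, h3, h4⟩ := hr (Ioo_subset_Icc_self hrI)
    exact ⟨hr' hrI, h1 hr0, h2 hr0, h3, h4⟩
  have hnT : ∀ᵐ r : ℝ, r ≠ T := by simp [ae_iff, measure_singleton]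
  -- the increment of the value is the integral of the remainder
  have hincr : ∀ y' ∈ Metric.ball y ρ,
      AEStronglyMeasurable (ω y') (volume.restrict (uIoc t T)) ∧
      (∫ r in t..T, G r (Φ y' r)) - (∫ r in t..T, G r (x r)) + inner ℝ (p t y) (y' - y)
        = ∫ r in t..T, ω y' r := by
    intro y' hy'
    set δ : ℝ → E := fun r => Φ y' r - x r with hδ
    set ψ : ℝ → ℝ := fun r => inner ℝ (q r) (δ r) with hψ
    have hδT := (hΦ y').1
    obtain ⟨Cx', hCx'⟩ := hδT.lipschitzOnWith hg
    have hδlip : LipschitzOnWith (Cx' + Cx) δ (Icc t T) := by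
      refine LipschitzOnWith.of_dist_le_mul fun s hs s' hs' => ?_
      have h1 := hCx'.dist_le_mul s hs s' hs'
      have h2 := hCx.dist_le_mul s hs s' hs'
      refine (dist_sub_sub_le _ _ _ _).trans ?_
      push_cast
      linarith
    have hδb : ∀ s ∈ Icc t T, ‖δ s‖ ≤ C * ‖y' - y‖ := fun s hs => (hC y' hy' y hyb s hs).1
    have hac : AbsolutelyContinuousOnInterval ψ t T := by
      refine LipschitzOnWith.absolutelyContinuousOnInterval
        (K := (Cp * max 1 Cx) * (C * ‖y' - y‖₊) + Q * (Cx' + Cx)) ?_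
      rw [uIcc_of_le htT]
      refine LipschitzOnWith.of_dist_le_mul fun s hs s' hs' => ?_
      have h1 := hqlip.dist_le_mul s hs s' hs'
      have h2 := hδlip.dist_le_mul s hs s' hs'
      rw [dist_eq_norm] at h1 h2 ⊢
      have h3 : ψ s - ψ s' = inner ℝ (q s - q s') (δ s) + inner ℝ (q s') (δ s - δ s') := by
        simp only [hψ, inner_sub_left, inner_sub_right]; ring
      rw [h3]
      calc _ ≤ ‖q s - q s'‖ * ‖δ s‖ + ‖q s'‖ * ‖δ s - δ s'‖ :=
            (norm_add_le _ _).trans (add_le_add (norm_inner_le_norm _ _) (norm_inner_le_norm _ _))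
        _ ≤ (↑(Cp * max 1 Cx) * dist s s') * (C * ‖y' - y‖)
            + Q * (↑(Cx' + Cx) * dist s s') := by
          have := hδb s hs
          have := hQ s' hs'
          gcongr
        _ = _ := by push_cast; ring
    have hψT : ψ T = 0 := by simp [hψ, hq, hp.terminal]
    have hψt : ψ t = inner ℝ (p t y) (y' - y) := by
      simp only [hψ, hq, hδ, hxt, (hΦ y').2]
    have hint := hac.integral_deriv_eq_sub
    have hdi : IntervalIntegrable (deriv ψ) volume t T := hac.intervalIntegrable_deriv
    have hGi' := hG.intervalIntegrable htT hδT.continuousOn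
    have hGi := hG.intervalIntegrable htT hxT.continuousOn
    have heq : ∀ᵐ r, r ∈ uIoc t T → G r (Φ y' r) - G r (x r) - deriv ψ r = ω y' r := by
      filter_upwards [hgoodr, hδT.ae_hasDerivAt hg htT, hnT] with r hr hr' hrT hrI
      rw [uIoc_of_le htT] at hrI
      have hrI' : r ∈ Ioo t T := ⟨hrI.1, lt_of_le_of_ne hrI.2 hrT⟩
      obtain ⟨h1, h2, h3, -, -⟩ := hr hrI'
      have h6 := IsAdjointState.hasDerivAt_inner h2 h3 h1 ((hr' hrI').sub h1)
      have h7 : deriv ψ r = _ := h6.deriv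
      rw [h7]
      simp only [hω, hq, inner_sub_right, Pi.sub_apply]
      ring
    have hae : (fun r => G r (Φ y' r) - G r (x r) - deriv ψ r)
        =ᵐ[volume.restrict (uIoc t T)] ω y' :=
      (ae_restrict_iff' measurableSet_uIoc).2 heq
    refine ⟨?_, ?_⟩
    · have h1 := ((hGi'.sub hGi).sub hdi).aestronglyMeasurable
      have h2 := ((hGi'.sub hGi).sub hdi).symm.aestronglyMeasurable
      rw [uIoc_of_le htT] at hae ⊢
      exact h1.congr hae
    · rw [← intervalIntegral.integral_congr_ae heq,
        intervalIntegral.integral_sub (hGi'.sub hGi) hdi,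
        intervalIntegral.integral_sub hGi' hGi, hint, hψT, hψt]
      ring
  -- domination of the remainder
  set Λ : ℝ := 2 * (LG + Q * Lg) * C with hΛ
  have hball : ∀ r ∈ Icc t T, Metric.closedBall (0 : E) (R + 1) ∈ 𝓝 (x r) := fun r hr =>
    Metric.closedBall_mem_nhds_of_mem (by
      rw [mem_ball_zero_iff]; linarith [hR y hyb r hr])
  have hmem : ∀ y' ∈ Metric.ball y ρ, ∀ r ∈ Icc t T,
      Φ y' r ∈ Metric.closedBall (0 : E) (R + 1) := fun y' hy' r hr => by
    rw [mem_closedBall_zero_iff]; linarith [hR y' hy' r hr]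
  have hdom : ∀ y' ∈ Metric.ball y ρ, ∀ r ∈ Icc t T, DifferentiableAt ℝ (g r) (x r) →
      DifferentiableAt ℝ (G r) (x r) → ‖ω y' r‖ ≤ Λ * ‖y' - y‖ := by
    intro y' hy' r hr h4 h5
    have hδ := (hC y' hy' y hyb r hr).1
    have hg1 := h4.hasFDerivAt.le_of_lipschitzOn (hball r hr) (hLg r)
    have hG1 := h5.hasFDerivAt.le_of_lipschitzOn (hball r hr) (hLG r)
    have hg2 := (hLg r).norm_sub_le (hmem y' hy' r hr) (hmem y hyb r hr)
    have hG2 := (hLG r).norm_sub_le (hmem y' hy' r hr) (hmem y hyb r hr)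
    have hg3 := (fderiv ℝ (g r) (x r)).le_of_opNorm_le hg1 (Φ y' r - x r)
    have hG3 := (fderiv ℝ (G r) (x r)).le_of_opNorm_le hG1 (Φ y' r - x r)
    have hgd : ‖g r (Φ y' r) - g r (x r) - fderiv ℝ (g r) (x r) (Φ y' r - x r)‖
        ≤ 2 * Lg * ‖Φ y' r - x r‖ := (norm_sub_le _ _).trans (by linarith)
    have hGd : ‖G r (Φ y' r) - G r (x r) - fderiv ℝ (G r) (x r) (Φ y' r - x r)‖
        ≤ 2 * LG * ‖Φ y' r - x r‖ := (norm_sub_le _ _).trans (by linarith)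
    calc ‖ω y' r‖ ≤ _ := norm_sub_le _ _
      _ ≤ 2 * LG * ‖Φ y' r - x r‖ + Q * (2 * Lg * ‖Φ y' r - x r‖) := by
        refine add_le_add hGd ((norm_inner_le_norm _ _).trans ?_)
        exact mul_le_mul (hQ r hr) hgd (norm_nonneg _) Q.2
      _ = 2 * (LG + Q * Lg) * ‖Φ y' r - x r‖ := by ring
      _ ≤ 2 * (LG + Q * Lg) * (C * ‖y' - y‖) := by gcongr
      _ = _ := by rw [hΛ]; ring
  have hpt : ∀ r ∈ Icc t T, DifferentiableAt ℝ (g r) (x r) → DifferentiableAt ℝ (G r) (x r) →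
      (fun y' => ω y' r) =o[𝓝 y] fun y' => y' - y := by
    intro r hr h4 h5
    have hcont : Tendsto (fun y' => Φ y' r) (𝓝 y) (𝓝 (x r)) :=
      (hΦ.continuous hg hr).continuousAt
    have hO : (fun y' => Φ y' r - x r) =O[𝓝 y] fun y' => y' - y :=
      Asymptotics.IsBigO.of_bound C (by
        filter_upwards [Metric.ball_mem_nhds y hρ] with y' hy'
        exact (hC y' hy' y hyb r hr).1)
    have h4' := (h4.hasFDerivAt.isLittleO.comp_tendsto hcont).trans_isBigO hO
    have h5' := (h5.hasFDerivAt.isLittleO.comp_tendsto hcont).trans_isBigO hO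
    have h6 : (fun y' => inner ℝ (q r)
        (g r (Φ y' r) - g r (x r) - fderiv ℝ (g r) (x r) (Φ y' r - x r)))
        =o[𝓝 y] fun y' => y' - y :=
      ((innerSL ℝ (q r)).isBigO_comp _ _).trans_isLittleO h4'
    exact h5'.sub h6
  rw [hasFDerivAt_iff_tendsto]
  have hlim : Tendsto (fun y' => ∫ r in t..T, ‖y' - y‖⁻¹ * ω y' r) (𝓝 y)
      (𝓝 (∫ r in t..T, (0 : ℝ))) := by
    refine intervalIntegral.tendsto_integral_filter_of_dominated_convergence (fun _ => Λ) ?_ ?_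
      intervalIntegrable_const ?_
    · filter_upwards [Metric.ball_mem_nhds y hρ] with y' hy'
      exact (hincr y' hy').1.const_mul _
    · filter_upwards [Metric.ball_mem_nhds y hρ] with y' hy'
      filter_upwards [hgoodr, hnT] with r hr hrT hrI
      rw [uIoc_of_le htT] at hrI
      obtain ⟨-, -, -, h4, h5⟩ := hr ⟨hrI.1, lt_of_le_of_ne hrI.2 hrT⟩
      have := hdom y' hy' r (Ioc_subset_Icc_self hrI) h4 h5
      rw [norm_mul, norm_inv, norm_norm]
      rcases eq_or_ne y' y with rfl | hne
      · have : 0 ≤ Λ := by positivity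
        simpa using this
      · rwa [inv_mul_le_iff₀ (norm_pos_iff.2 (sub_ne_zero.2 hne)), mul_comm]
    · filter_upwards [hgoodr, hnT] with r hr hrT hrI
      rw [uIoc_of_le htT] at hrI
      obtain ⟨-, -, -, h4, h5⟩ := hr ⟨hrI.1, lt_of_le_of_ne hrI.2 hrT⟩
      have := (hpt r (Ioc_subset_Icc_self hrI) h4 h5).norm_right.tendsto_div_nhds_zero
      refine this.congr fun y' => ?_
      rw [div_eq_inv_mul]
  rw [intervalIntegral.integral_zero] at hlim
  have hlim' := hlim.norm
  rw [norm_zero] at hlim'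
  refine hlim'.congr' ?_
  filter_upwards [Metric.ball_mem_nhds y hρ] with y' hy'
  rw [intervalIntegral.integral_const_mul, norm_mul, norm_inv, norm_norm, ← (hincr y' hy').2]
  simp [hx]

/-- The value is continuously differentiable in the initial point, with gradient `-p`. -/
theorem IsAdjointState.hasFDerivAt_value {g : ℝ → E → E} {G : ℝ → E → ℝ} {T : ℝ}
    {μ : Measure E} [μ.IsAddHaarMeasure] {p : ℝ → E → E} (hp : IsAdjointState g G T μ p)
    (hg : IsCaratheodoryField g) (hG : IsCaratheodoryField G) {t : ℝ} (ht : t ∈ Icc 0 T)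
    {Φ : E → ℝ → E} (hΦ : IsFlowFrom g t T Φ) (y : E) :
    HasFDerivAt (fun y => ∫ r in t..T, G r (Φ y r)) (-(innerSL ℝ (p t y))) y :=
  hasFDerivAt_of_ae_hasFDerivAt μ (A := fun y => -(innerSL ℝ (p t y)))
    (((innerSL ℝ).continuous.comp (hp.continuous ht)).neg)
    (hΦ.exists_ball_lipschitzOnWith_value hg hG ht.2) (hp.ae_hasFDerivAt_value hg hG ht hΦ) y

end Value

/-! ### The verification identity -/

theorem eq_of_abs_sub_le_mul_sq {D : ℝ → ℝ} {a b C η : ℝ} (hη : 0 < η) (hab : a ≤ b)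
    (h : ∀ s ∈ Icc a b, ∀ s' ∈ Icc a b, s ≤ s' → s' - s ≤ η → |D s' - D s| ≤ C * (s' - s) ^ 2) :
    D b = D a := by
  have hd : ∀ s ∈ Icc a b, HasDerivWithinAt D 0 (Icc a b) s := by
    intro s hs
    rw [hasDerivWithinAt_iff_isLittleO, Asymptotics.isLittleO_iff]
    intro c hc
    set κ := min η (c / (|C| + 1)) with hκ
    have hκ0 : 0 < κ := lt_min hη (by positivity)
    filter_upwards [self_mem_nhdsWithin, mem_nhdsWithin_of_mem_nhds (Metric.ball_mem_nhds s hκ0)]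
      with s' hs' hball
    rw [Metric.mem_ball, Real.dist_eq] at hball
    have hsq : |D s' - D s| ≤ C * (s' - s) ^ 2 := by
      have hle := hball.le.trans (min_le_left _ _)
      rcases le_total s s' with hss | hss
      · exact h s hs s' hs' hss ((le_abs_self _).trans hle)
      · rw [abs_sub_comm] at hle
        rw [abs_sub_comm, ← neg_sub s s', neg_sq]
        exact h s' hs' s hs hss ((le_abs_self _).trans hle)
    rw [smul_zero, sub_zero, Real.norm_eq_abs, Real.norm_eq_abs]
    have h1 : |s' - s| * (|C| + 1) ≤ c := by
      rw [← le_div_iff₀ (by positivity)]; exact hball.le.trans (min_le_right _ _)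
    rw [← sq_abs] at hsq
    nlinarith [le_abs_self C, abs_nonneg (s' - s), sq_nonneg |s' - s|, abs_nonneg C,
      mul_le_mul_of_nonneg_right h1 (abs_nonneg (s' - s)),
      mul_le_mul_of_nonneg_right (le_abs_self C) (sq_nonneg |s' - s|)]
  refine constant_of_derivWithin_zero (fun s hs => (hd s hs).differentiableWithinAt)
    (fun s hs => ?_) b (right_mem_Icc.2 hab)
  exact (hd s (Ico_subset_Icc_self hs)).derivWithin
    (uniqueDiffOn_Icc (hs.1.trans_lt hs.2) s (Ico_subset_Icc_self hs))

section Verification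

variable {E : Type*} [NormedAddCommGroup E] [InnerProductSpace ℝ E] [FiniteDimensional ℝ E]
  [MeasurableSpace E] [BorelSpace E]

/-- Dynamic programming principle. -/
theorem IsFlowFrom.value_eq_add {g : ℝ → E → E} (hg : IsCaratheodoryField g) {G : ℝ → E → ℝ}
    (hG : IsCaratheodoryField G) {s s' T : ℝ} (hss : s ≤ s') (hsT : s' ≤ T) {Φ Φ' : E → ℝ → E}
    (hΦ : IsFlowFrom g s T Φ) (hΦ' : IsFlowFrom g s' T Φ') (y : E) :
    ∫ r in s..T, G r (Φ y r)
      = (∫ r in s..s', G r (Φ y r)) + ∫ r in s'..T, G r (Φ' (Φ y s') r) := by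
  have hx := (hΦ y).1
  have h1 : EqOn (Φ' (Φ y s')) (Φ y) (Icc s' T) :=
    (hΦ' _).1.eqOn hg (hx.mono hg hss le_rfl) (hΦ' _).2
  rw [← intervalIntegral.integral_add_adjacent_intervals
    (hG.intervalIntegrable hss (hx.continuousOn.mono (Icc_subset_Icc_right hsT)))
    (hG.intervalIntegrable hsT (hx.continuousOn.mono (Icc_subset_Icc_left hss)))]
  congr 1
  refine intervalIntegral.integral_congr fun r hr => ?_
  rw [uIcc_of_le hsT] at hr
  simp only [h1 hr]

/-- The value of the field `g` at the starting point of an arbitrary curve `X` with bounded velocity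
`w`, as an integral along `X`: the derivative of the value along `X` is
`-G - ⟪p, w - g⟫`. The increments of the value are compared over short intervals with those along
the trajectory of `g` that starts on the curve; the two differ to second order only. -/
theorem IsAdjointState.value_eq_integral {g : ℝ → E → E} {G : ℝ → E → ℝ} {T : ℝ}
    {μ : Measure E} [μ.IsAddHaarMeasure] {p : ℝ → E → E} (hp : IsAdjointState g G T μ p)
    (hg : IsCaratheodoryField g) (hG : IsCaratheodoryField G) {Φ : ℝ → E → ℝ → E}
    (hΦ : ∀ t ∈ Icc 0 T, IsFlowFrom g t T (Φ t)) {t : ℝ} (ht : t ∈ Icc 0 T) {X w : ℝ → E} {Mw : ℝ}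
    (hw : IntervalIntegrable w volume t T) (hwM : ∀ r ∈ Icc t T, ‖w r‖ ≤ Mw)
    (hX : ∀ s ∈ Icc t T, X s = X t + ∫ r in t..s, w r) :
    IntervalIntegrable (fun r => G r (X r) + inner ℝ (p r (X r)) (w r - g r (X r))) volume t T ∧
    ∫ r in t..T, G r (Φ t (X t) r)
      = ∫ r in t..T, (G r (X r) + inner ℝ (p r (X r)) (w r - g r (X r))) := by
  have htT := ht.2
  have hMw : 0 ≤ Mw := (norm_nonneg _).trans (hwM t (left_mem_Icc.2 htT))
  have hwi : ∀ s ∈ Icc t T, ∀ s' ∈ Icc t T, s ≤ s' → IntervalIntegrable w volume s s' :=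
    fun s hs s' hs' hss => hw.mono_set (by
      rw [uIcc_of_le hss, uIcc_of_le htT]; exact Icc_subset_Icc hs.1 hs'.2)
  have hXincr : ∀ s ∈ Icc t T, ∀ s' ∈ Icc t T, s ≤ s' → X s' - X s = ∫ r in s..s', w r := by
    intro s hs s' hs' hss
    rw [hX s hs, hX s' hs', ← intervalIntegral.integral_add_adjacent_intervals
      (hwi t (left_mem_Icc.2 htT) s hs hs.1) (hwi s hs s' hs' hss)]
    abel
  have hXlip : ∀ s ∈ Icc t T, ∀ s' ∈ Icc t T, s ≤ s' → ‖X s' - X s‖ ≤ Mw * (s' - s) := by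
    intro s hs s' hs' hss
    rw [hXincr s hs s' hs' hss, ← abs_of_nonneg (sub_nonneg.2 hss)]
    refine intervalIntegral.norm_integral_le_of_norm_le_const fun r hr => ?_
    rw [uIoc_of_le hss] at hr
    exact hwM r ⟨hs.1.trans hr.1.le, hr.2.trans hs'.2⟩
  have hXc : ContinuousOn X (Icc t T) := by
    have h1 := intervalIntegral.continuousOn_primitive_interval' hw left_mem_uIcc
    rw [uIcc_of_le htT] at h1
    exact (continuousOn_const.add h1).congr hX
  obtain ⟨R, hR0, hR⟩ := hXc.exists_norm_le_Icc
  obtain ⟨L, hL⟩ := hg.lipschitz (R + 1)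
  obtain ⟨LG, hLG⟩ := hG.lipschitz (R + 1)
  obtain ⟨Mg, hMg⟩ := hg.bounded (R + 1)
  obtain ⟨Cp, hCp⟩ := hp.exists_lipschitzOnWith (R + 1)
  have hXm : ∀ r ∈ Icc t T, X r ∈ Metric.closedBall (0 : E) (R + 1) := fun r hr => by
    rw [mem_closedBall_zero_iff]; linarith [hR r hr]
  have hMg0 : 0 ≤ Mg := (norm_nonneg _).trans (hMg t _ (hXm t (left_mem_Icc.2 htT)))
  have h0t : ∀ r ∈ Icc t T, r ∈ Icc 0 T := fun r hr => ⟨ht.1.trans hr.1, hr.2⟩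
  have hpc : ContinuousOn (fun r => p r (X r)) (Icc t T) :=
    hCp.continuousOn.comp (continuousOn_id.prodMk hXc) fun r hr => ⟨h0t r hr, hXm r hr⟩
  obtain ⟨Q, hQ0, hQ⟩ := hpc.exists_norm_le_Icc
  have hgX := hg.intervalIntegrable htT hXc
  have hGX := hG.intervalIntegrable htT hXc
  set A := Mw + Mg with hA
  have hwg : ∀ r ∈ Icc t T, ‖w r - g r (X r)‖ ≤ A := fun r hr =>
    (norm_sub_le _ _).trans (add_le_add (hwM r hr) (hMg r _ (hXm r hr)))
  have hpi : IntervalIntegrable (fun r => inner ℝ (p r (X r)) (w r - g r (X r))) volume t T := by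
    refine intervalIntegrable_of_norm_le htT (M := Q * A) ?_ fun r hr =>
      (norm_inner_le_norm _ _).trans
        (mul_le_mul (hQ r hr) (hwg r hr) (norm_nonneg _) hQ0)
    have h1 : AEStronglyMeasurable (fun r => w r - g r (X r)) (volume.restrict (Icc t T)) := by
      have := (intervalIntegrable_iff_integrableOn_Icc_of_le htT).1 (hw.sub hgX)
      exact this.aestronglyMeasurable
    exact (hpc.aestronglyMeasurable measurableSet_Icc).inner h1
  set k : ℝ → ℝ := fun r => G r (X r) + inner ℝ (p r (X r)) (w r - g r (X r)) with hk
  have hki : IntervalIntegrable k volume t T := hGX.add hpi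
  refine ⟨hki, ?_⟩
  set V : ℝ → E → ℝ := fun s y => ∫ r in s..T, G r (Φ s y r) with hV
  set D : ℝ → ℝ := fun s => V s (X s) + ∫ r in t..s, k r with hD
  set B := A * Real.exp (L * (T - t)) with hB
  have hB0 : 0 ≤ B := mul_nonneg (add_nonneg hMw hMg0) (Real.exp_pos _).le
  have key : D T = D t := by
    refine eq_of_abs_sub_le_mul_sq (η := 1 / (B + 1)) (by positivity) htT
      (C := Cp * B * B + (LG * B + Cp * (1 + Mw) * A + Q * (L * B)))
      fun s hs s' hs' hss hη => ?_
    have hs0 := h0t s hs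
    have hs0' := h0t s' hs'
    set Δ := s' - s with hΔ
    have hΔ0 : 0 ≤ Δ := sub_nonneg.2 hss
    have hsub : Icc s s' ⊆ Icc t T := Icc_subset_Icc hs.1 hs'.2
    have hx := (hΦ s hs0 (X s)).1.mono hg le_rfl hs'.2
    have hxs := (hΦ s hs0 (X s)).2
    set x := Φ s (X s) with hxdef
    have hBΔ : B * Δ < 1 := by
      rw [le_div_iff₀ (by positivity)] at hη
      nlinarith
    have hclose : ∀ r ∈ Icc s s', ‖x r - X r‖ ≤ B * Δ := by
      refine hx.norm_sub_le hg hL (M := A) (hXc.mono hsub) (fun r hr => hR r (hsub hr))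
        (hwi s hs s' hs' hss) (fun r hr => ?_) (fun r hr => hwg r (hsub hr))
        (add_nonneg hMw hMg0) ?_ hBΔ
      · rw [← hXincr s hs r (hsub hr) hr.1]; abel
      · rw [hxs, sub_self, norm_zero, zero_add, hB, mul_right_comm]
        refine mul_le_mul_of_nonneg_right (mul_le_mul_of_nonneg_left ?_
          (add_nonneg hMw hMg0)) hΔ0
        exact Real.exp_le_exp.2 (mul_le_mul_of_nonneg_left (by linarith [hs.1, hs'.2]) L.2)
    have hxm : ∀ r ∈ Icc s s', x r ∈ Metric.closedBall (0 : E) (R + 1) := fun r hr => by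
      rw [mem_closedBall_zero_iff]
      have := norm_add_le (X r) (x r - X r)
      rw [add_sub_cancel] at this
      linarith [hR r (hsub hr), hclose r hr]
    have hs's : s' ∈ Icc s s' := right_mem_Icc.2 hss
    set P := p s' (X s') with hP
    -- first order expansion of the value at time `s'`
    have hmv : ‖V s' (x s') - V s' (X s') - (-(innerSL ℝ P)) (x s' - X s')‖
        ≤ Cp * (B * Δ) * ‖x s' - X s'‖ := by
      refine (convex_closedBall (X s') (B * Δ)).norm_image_sub_le_of_norm_hasFDerivWithin_le'
        (f' := fun z => -(innerSL ℝ (p s' z)))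
        (fun z _ => (hp.hasFDerivAt_value hg hG hs0' (hΦ s' hs0') z).hasFDerivWithinAt)
        (fun z hz => ?_) (Metric.mem_closedBall_self (by positivity))
        (by rw [mem_closedBall_iff_norm]; exact hclose s' hs's)
      rw [mem_closedBall_iff_norm] at hz
      have hzm : z ∈ Metric.closedBall (0 : E) (R + 1) := by
        rw [mem_closedBall_zero_iff]
        have := norm_add_le (X s') (z - X s')
        rw [add_sub_cancel] at this
        linarith [hR s' hs']
      rw [← neg_sub', ← map_sub, norm_neg, innerSL_apply_norm]
      have h1 := hCp.norm_sub_le (x := (s', z)) ⟨hs0', hzm⟩ (y := (s', X s')) ⟨hs0', hXm s' hs'⟩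
      simp only [Function.uncurry_apply_pair, Prod.mk_sub_mk, sub_self, Prod.norm_mk, norm_zero,
        norm_nonneg, sup_of_le_right] at h1
      exact h1.trans (mul_le_mul_of_nonneg_left hz Cp.2)
    have hdyn : V s (X s) = (∫ r in s..s', G r (x r)) + V s' (x s') :=
      (hΦ s hs0).value_eq_add hg hG hss hs'.2 (hΦ s' hs0') (X s)
    have hgx := hg.intervalIntegrable hss hx.continuousOn
    have hGx := hG.intervalIntegrable hss hx.continuousOn
    have hu : uIcc s s' ⊆ uIcc t T := by rw [uIcc_of_le hss, uIcc_of_le htT]; exact hsub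
    have hus : uIcc t s ⊆ uIcc t T := by
      rw [uIcc_of_le hs.1, uIcc_of_le htT]; exact Icc_subset_Icc_right hs.2
    have hk' := hki.mono_set hu
    have hkadd := intervalIntegral.integral_add_adjacent_intervals (hki.mono_set hus) hk'
    have hdiff : X s' - x s' = ∫ r in s..s', (w r - g r (x r)) := by
      have h1 := hx.integral_eq_sub hg le_rfl hss le_rfl
      rw [intervalIntegral.integral_sub (hwi s hs s' hs' hss) hgx, h1,
        ← hXincr s hs s' hs' hss, hxs]
      abel
    have hPint : inner ℝ P (X s' - x s') = ∫ r in s..s', inner ℝ P (w r - g r (x r)) := by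
      rw [hdiff]
      exact ((innerSL ℝ P).intervalIntegral_comp_comm ((hwi s hs s' hs' hss).sub hgx)).symm
    have hPi : IntervalIntegrable (fun r => inner ℝ P (w r - g r (x r))) volume s s' := by
      have h1 := (hwi s hs s' hs' hss).sub hgx
      rw [intervalIntegrable_iff] at h1 ⊢
      exact (innerSL ℝ P).integrable_comp h1
    have hrep : D s' - D s = -(V s' (x s') - V s' (X s') - (-(innerSL ℝ P)) (x s' - X s'))
        + ∫ r in s..s', (k r - G r (x r) - inner ℝ P (w r - g r (x r))) := by
      rw [intervalIntegral.integral_sub (hk'.sub hGx) hPi, intervalIntegral.integral_sub hk' hGx,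
        ← hPint]
      simp only [hD, hdyn, ← hkadd, neg_apply, innerSL_apply_apply, inner_sub_right]
      ring
    have hbound : ‖∫ r in s..s', (k r - G r (x r) - inner ℝ P (w r - g r (x r)))‖
        ≤ (LG * B + Cp * (1 + Mw) * A + Q * (L * B)) * Δ * |s' - s| := by
      refine intervalIntegral.norm_integral_le_of_norm_le_const fun r hr => ?_
      rw [uIoc_of_le hss] at hr
      have hr' : r ∈ Icc s s' := Ioc_subset_Icc_self hr
      have hrt := hsub hr'
      have h1 : k r - G r (x r) - inner ℝ P (w r - g r (x r))
          = (G r (X r) - G r (x r)) + inner ℝ (p r (X r) - P) (w r - g r (X r))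
            + inner ℝ P (g r (x r) - g r (X r)) := by
        simp only [hk, inner_sub_left, inner_sub_right]; ring
      have h2 : ‖G r (X r) - G r (x r)‖ ≤ LG * (B * Δ) := by
        rw [norm_sub_rev]
        exact ((hLG r).norm_sub_le (hxm r hr') (hXm r hrt)).trans
          (mul_le_mul_of_nonneg_left (hclose r hr') LG.2)
      have h3 : ‖g r (x r) - g r (X r)‖ ≤ L * (B * Δ) :=
        ((hL r).norm_sub_le (hxm r hr') (hXm r hrt)).trans
          (mul_le_mul_of_nonneg_left (hclose r hr') L.2)
      have h4 : ‖p r (X r) - P‖ ≤ Cp * ((1 + Mw) * Δ) := by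
        have h5 := hCp.norm_sub_le (x := (s', X s')) ⟨hs0', hXm s' hs'⟩
          (y := (r, X r)) ⟨h0t r hrt, hXm r hrt⟩
        rw [norm_sub_rev]
        refine h5.trans (mul_le_mul_of_nonneg_left ?_ Cp.2)
        rw [Prod.mk_sub_mk, Prod.norm_mk, Real.norm_of_nonneg (sub_nonneg.2 hr.2)]
        have h6 := hXlip r hrt s' hs' hr.2
        have h7 : s' - r ≤ Δ := by rw [hΔ]; linarith [hr.1]
        have h8 := mul_le_mul_of_nonneg_left h7 hMw
        have h9 := mul_nonneg hMw hΔ0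
        exact max_le (by linarith) (by linarith)
      rw [h1]
      calc _ ≤ ‖G r (X r) - G r (x r)‖ + ‖p r (X r) - P‖ * ‖w r - g r (X r)‖
            + ‖P‖ * ‖g r (x r) - g r (X r)‖ :=
            (norm_add_le _ _).trans (add_le_add ((norm_add_le _ _).trans
              (add_le_add le_rfl (norm_inner_le_norm _ _))) (norm_inner_le_norm _ _))
        _ ≤ LG * (B * Δ) + (Cp * ((1 + Mw) * Δ)) * A + Q * (L * (B * Δ)) := by
          have := hwg r hrt
          have := hQ s' hs'
          gcongr
        _ = _ := by ring
    rw [hrep, ← Real.norm_eq_abs]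
    refine (norm_add_le _ _).trans ?_
    rw [norm_neg]
    rw [abs_of_nonneg (sub_nonneg.2 hss)] at hbound
    have hmv' := hmv.trans (mul_le_mul_of_nonneg_left (hclose s' hs's) (by positivity))
    calc _ ≤ _ := add_le_add hmv' hbound
      _ = _ := by rw [← hΔ]; ring
  simp only [hD, hV, intervalIntegral.integral_same, zero_add, add_zero] at key
  exact key.symm

end Verification

/-! ### Regular controls and closed-loop fields -/

section Controls

variable {E V F : Type*} [NormedAddCommGroup E] [InnerProductSpace ℝ E] [FiniteDimensional ℝ E]
  [MeasurableSpace E] [BorelSpace E] [NormedAddCommGroup V] [InnerProductSpace ℝ V]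
  [FiniteDimensional ℝ V] [MeasurableSpace V] [BorelSpace V] [NormedAddCommGroup F]
  [InnerProductSpace ℝ F] [FiniteDimensional ℝ F] [MeasurableSpace F] [BorelSpace F]

/-- A feedback control that is jointly measurable, and `K`-valued and `L`-Lipschitz at every time,
rather than at almost every time. -/
structure IsRegularControl (K : Set V) (L : ℝ≥0) (w : ℝ → E → V) : Prop where
  measurable : Measurable (Function.uncurry w)
  mem : ∀ t x, w t x ∈ K
  lipschitz : ∀ t, LipschitzWith L (w t)

/-- The field `φ (x, w (t, x))` obtained by inserting the feedback `w` in `φ`. -/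
abbrev closedLoop (φ : E → V → F) (w : ℝ → E → V) : ℝ → E → F := fun t x => φ x (w t x)

/-- Every feasible feedback agrees, at almost every time, with a regular control. -/
theorem exists_isRegularControl {K : Set V} (hK : K.Nonempty) {T : ℝ} {L : ℝ≥0} {w : ℝ → E → V}
    (hm : ∀ x, AEMeasurable (fun t => w t x) (volume.restrict (Ioo 0 T)))
    (hmem : ∀ᵐ t, t ∈ Ioo 0 T → ∀ x, w t x ∈ K)
    (hL : ∀ᵐ t, t ∈ Ioo 0 T → LipschitzWith L (w t)) :
    ∃ w', IsRegularControl K L w' ∧ ∀ᵐ t, t ∈ Ioo 0 T → w' t = w t := by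
  classical
  obtain ⟨v₀, hv₀⟩ := hK
  set d : ℕ → E := TopologicalSpace.denseSeq E
  have hd : DenseRange d := TopologicalSpace.denseRange_denseSeq E
  have hmk : ∀ᵐ t, t ∈ Ioo 0 T → ∀ j, w t (d j) = (hm (d j)).mk _ t := by
    have h1 : ∀ j, ∀ᵐ t, t ∈ Ioo 0 T → w t (d j) = (hm (d j)).mk _ t := fun j =>
      (ae_restrict_iff' measurableSet_Ioo).1 (hm (d j)).ae_eq_mk
    filter_upwards [ae_all_iff.2 h1] with t ht hT j using ht j hT
  -- outside a measurable null set of times, which `S` leaves out, all the properties of a feasible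
  -- map hold together; the values on a dense sequence determine the others by continuity
  set P : ℝ → Prop := fun t => t ∈ Ioo 0 T → (∀ x, w t x ∈ K) ∧ LipschitzWith L (w t) ∧
    ∀ j, w t (d j) = (hm (d j)).mk _ t with hP
  have hPae : ∀ᵐ t, P t := by
    filter_upwards [hmem, hL, hmk] with t h1 h2 h3 hT using ⟨h1 hT, h2 hT, h3 hT⟩
  set S : Set ℝ := Ioo 0 T \ toMeasurable volume {t | ¬ P t} with hS
  have hSm : MeasurableSet S := measurableSet_Ioo.diff (measurableSet_toMeasurable _ _)
  have hSP : ∀ t ∈ S, (∀ x, w t x ∈ K) ∧ LipschitzWith L (w t) ∧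
      ∀ j, w t (d j) = (hm (d j)).mk _ t := fun t ht => by
    by_contra hn
    exact ht.2 (subset_toMeasurable _ _ fun h => hn (h ht.1))
  set w' : ℝ → E → V := fun t x => if t ∈ S then w t x else v₀ with hw'
  have hw'pos : ∀ t ∈ S, w' t = w t := fun t ht => by
    funext x; simp only [hw', ht, if_true]
  have hw'neg : ∀ t ∉ S, w' t = fun _ => v₀ := fun t ht => by
    funext x; simp only [hw', ht, if_false]
  have hlip : ∀ t, LipschitzWith L (w' t) := fun t => by
    by_cases ht : t ∈ S
    · rw [hw'pos t ht]; exact (hSP t ht).2.1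
    · rw [hw'neg t ht]; exact LipschitzWith.const' v₀
  have hmd : ∀ j, Measurable fun t => w' t (d j) := fun j => by
    have h1 : (fun t => w' t (d j)) = S.piecewise ((hm (d j)).mk _) fun _ => v₀ := by
      funext t
      by_cases ht : t ∈ S
      · rw [piecewise_eq_of_mem _ _ _ ht, hw'pos t ht]; exact (hSP t ht).2.2 j
      · rw [piecewise_eq_of_notMem _ _ _ ht, hw'neg t ht]
    rw [h1]
    exact (hm (d j)).measurable_mk.piecewise hSm measurable_const
  have hmx : ∀ x, Measurable fun t => w' t x := fun x => by
    obtain ⟨u, hu, hlim⟩ := mem_closure_iff_seq_limit.1 (hd x)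
    choose j hj using hu
    refine measurable_of_tendsto_metrizable (f := fun n t => w' t (u n)) (fun n => ?_)
      (tendsto_pi_nhds.2 fun t => ((hlip t).continuous.tendsto x).comp hlim)
    rw [← hj n]; exact hmd (j n)
  refine ⟨w', ⟨?_, fun t x => ?_, hlip⟩, ?_⟩
  · have h1 : Measurable (Function.uncurry fun x t => w' t x) :=
      measurable_uncurry_of_continuous_of_measurable (fun t => (hlip t).continuous) hmx
    exact h1.comp measurable_swap
  · by_cases ht : t ∈ S
    · rw [hw'pos t ht]; exact (hSP t ht).1 x
    · rw [hw'neg t ht]; exact hv₀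
  · have h1 : ∀ᵐ t, t ∉ toMeasurable volume {t | ¬ P t} := by
      rw [ae_iff]
      simp only [not_not, ofPred_mem_eq, measure_toMeasurable]
      exact hPae
    filter_upwards [h1] with t ht hT using hw'pos t ⟨hT, ht⟩

theorem exists_lipschitzOnWith_closedBall_prod {K : Set V} (hK : IsCompact K) {φ : E → V → F}
    (hφ : ∀ x, ∀ v ∈ K, ContDiffAt ℝ 1 (Function.uncurry φ) (x, v)) (R : ℝ) :
    ∃ C : ℝ≥0, LipschitzOnWith C (Function.uncurry φ) (Metric.closedBall 0 R ×ˢ K) := by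
  refine LocallyLipschitzOn.exists_lipschitzOnWith_of_compact
    ((isCompact_closedBall _ _).prod hK) fun z hz => ?_
  obtain ⟨C, s, hs, hC⟩ := (hφ z.1 z.2 hz.2).exists_lipschitzOnWith
  exact ⟨C, s, mem_nhdsWithin_of_mem_nhds hs, hC⟩

theorem IsRegularControl.lipschitzOnWith_closedLoop {K : Set V} {L : ℝ≥0} {w : ℝ → E → V}
    (hw : IsRegularControl K L w) {φ : E → V → F} {R : ℝ} {C : ℝ≥0}
    (hC : LipschitzOnWith C (Function.uncurry φ) (Metric.closedBall 0 R ×ˢ K)) (t : ℝ) :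
    LipschitzOnWith (C * max 1 L) (closedLoop φ w t) (Metric.closedBall 0 R) :=
  hC.comp ((LipschitzWith.id.prodMk (hw.lipschitz t)).lipschitzOnWith) fun x hx => ⟨hx, hw.mem t x⟩

theorem IsRegularControl.isCaratheodoryField {K : Set V} (hK : IsCompact K) {L : ℝ≥0}
    {w : ℝ → E → V} (hw : IsRegularControl K L w) {φ : E → V → F}
    (hφ : ∀ x, ∀ v ∈ K, ContDiffAt ℝ 1 (Function.uncurry φ) (x, v)) :
    IsCaratheodoryField (closedLoop φ w) where
  measurable := by
    have h1 : Continuous ((univ ×ˢ K : Set (E × V)).domRestrict (Function.uncurry φ)) :=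
      continuousOn_iff_continuous_domRestrict.1 fun z hz =>
        (hφ z.1 z.2 hz.2).continuousAt.continuousWithinAt
    have h2 : Measurable fun z : ℝ × E => (z.2, w z.1 z.2) := measurable_snd.prodMk hw.measurable
    exact h1.measurable.comp
      (h2.subtype_mk (p := fun q => q ∈ univ ×ˢ K) (h := fun z => ⟨mem_univ _, hw.mem _ _⟩))
  lipschitz R := by
    obtain ⟨C, hC⟩ := exists_lipschitzOnWith_closedBall_prod hK hφ R
    exact ⟨_, hw.lipschitzOnWith_closedLoop hC⟩
  bounded R := by
    obtain ⟨C, hC⟩ := exists_lipschitzOnWith_closedBall_prod hK hφ R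
    obtain ⟨M, hM⟩ := ((isCompact_closedBall (0 : E) R).prod hK).exists_bound_of_continuousOn
      hC.continuousOn
    exact ⟨M, fun t x hx => hM (x, w t x) ⟨hx, hw.mem t x⟩⟩

theorem IsRegularControl.variation {K : Set V} (hKc : Convex ℝ K) {L L' : ℝ≥0}
    {u U : ℝ → E → V} (hu : IsRegularControl K L u) (hU : IsRegularControl K L' U) {ε : ℝ}
    (hε : ε ∈ Icc (0 : ℝ) 1) :
    IsRegularControl K (L + (L' + L)) fun t x => u t x + ε • (U t x - u t x) where
  measurable := hu.measurable.add ((hU.measurable.sub hu.measurable).const_smul ε)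
  mem t x := hKc.add_smul_sub_mem (hu.mem t x) (hU.mem t x) hε
  lipschitz t := by
    refine (hu.lipschitz t).add (((lipschitzWith_smul ε).comp
      ((hU.lipschitz t).sub (hu.lipschitz t))).weaken ?_)
    have h1 : ‖ε‖₊ ≤ 1 := by
      rw [← NNReal.coe_le_coe, coe_nnnorm, Real.norm_of_nonneg hε.1]; exact hε.2
    exact mul_le_of_le_one_left' h1

/-- Difference quotients in the second variable with moving base point. -/
theorem HasStrictFDerivAt.tendsto_slope_snd {f : E × V → F} {f' : E × V →L[ℝ] F} {x₀ : E}
    {v₀ d₀ : V} (hf : HasStrictFDerivAt f f' (x₀, v₀)) {x : ℝ → E} {v d : ℝ → V}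
    (hx : Tendsto x (𝓝[>] 0) (𝓝 x₀)) (hv : Tendsto v (𝓝[>] 0) (𝓝 v₀))
    (hd : Tendsto d (𝓝[>] 0) (𝓝 d₀)) :
    Tendsto (fun ε : ℝ => ε⁻¹ • (f (x ε, v ε + ε • d ε) - f (x ε, v ε))) (𝓝[>] 0)
      (𝓝 (f' (0, d₀))) := by
  have hid : Tendsto (fun ε : ℝ => ε) (𝓝[>] 0) (𝓝 0) := tendsto_id.mono_left nhdsWithin_le_nhds
  have hv' : Tendsto (fun ε => v ε + ε • d ε) (𝓝[>] 0) (𝓝 v₀) := by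
    simpa using hv.add (hid.smul hd)
  have h1 := hf.isLittleO.comp_tendsto
    ((hx.prodMk_nhds hv').prodMk_nhds (hx.prodMk_nhds hv))
  have h2 : (fun ε : ℝ => ((x ε, v ε + ε • d ε) - (x ε, v ε) : E × V)) =O[𝓝[>] 0]
      fun ε : ℝ => ε := by
    have h3 : (fun ε : ℝ => ε • ((0, d ε) : E × V)) =O[𝓝[>] 0] fun ε : ℝ => ε • (1 : ℝ) :=
      (Asymptotics.isBigO_refl _ _).smul
        ((tendsto_const_nhds.prodMk_nhds hd).isBigO_one ℝ)
    simpa using h3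
  have h3 := (h1.trans_isBigO h2).tendsto_inv_smul_nhds_zero
  have h4 : Tendsto (fun ε => f' (0, d ε)) (𝓝[>] 0) (𝓝 (f' (0, d₀))) :=
    (f'.continuous.tendsto _).comp (tendsto_const_nhds.prodMk_nhds hd)
  have h5 := h3.add h4
  rw [zero_add] at h5
  refine h5.congr' ?_
  filter_upwards [self_mem_nhdsWithin] with ε hε
  have hε0 : ε ≠ 0 := (mem_Ioi.1 hε).ne'
  have h6 : ((x ε, v ε + ε • d ε) - (x ε, v ε) : E × V) = ε • (0, d ε) := by simp
  simp only [Function.comp_apply]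
  rw [h6, map_smul, smul_sub ε⁻¹ (f _ - f _), inv_smul_smul₀ hε0, sub_add_cancel]

end Controls

/-! ### Costs of regular feedback controls -/

section Cost

variable {N m : ℕ} {K : Set (EuclideanSpace ℝ (Fin m))} {T : ℝ}
  {F : EuclideanSpace ℝ (Fin N) → EuclideanSpace ℝ (Fin m) → ℝ}
  {f : EuclideanSpace ℝ (Fin N) → EuclideanSpace ℝ (Fin m) → EuclideanSpace ℝ (Fin N)}
  {u U w w' : FeedbackField (EuclideanSpace ℝ (Fin N)) (EuclideanSpace ℝ (Fin m))}
  {p : FeedbackField (EuclideanSpace ℝ (Fin N)) (EuclideanSpace ℝ (Fin N))}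

theorem ae_mem_uIoc_imp_mem_Ioo {t : ℝ} (ht : t ∈ Icc 0 T) :
    ∀ᵐ r, r ∈ uIoc t T → r ∈ Ioo t T ∧ r ∈ Ioo 0 T := by
  have hnT : ∀ᵐ r : ℝ, r ≠ T := by simp [ae_iff, measure_singleton]
  filter_upwards [hnT] with r hr hrI
  rw [uIoc_of_le ht.2] at hrI
  have h := lt_of_le_of_ne hrI.2 hr
  exact ⟨⟨hrI.1, h⟩, ht.1.trans_lt hrI.1, h⟩

theorem IsState.congr (h : ∀ᵐ t, t ∈ Ioo 0 T → w t = w' t) {t : ℝ} (ht : t ∈ Icc 0 T)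
    {y : EuclideanSpace ℝ (Fin N)} {x : ℝ → EuclideanSpace ℝ (Fin N)}
    (hx : IsState f w T t y x) : IsState f w' T t y x := by
  have hae : ∀ᵐ r, r ∈ uIoc t T → f (x r) (w r (x r)) = f (x r) (w' r (x r)) := by
    filter_upwards [h, ae_mem_uIoc_imp_mem_Ioo ht] with r hr hr' hrI
    rw [hr (hr' hrI).2]
  refine ⟨hx.continuousOn, ?_, fun s hs => ?_⟩
  · exact hx.integrable.congr_ae ((ae_restrict_iff' measurableSet_uIoc).2 hae)
  · rw [hx.eq_integral s hs]
    congr 1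
    refine intervalIntegral.integral_congr_ae ?_
    filter_upwards [hae] with r hr hrI
    refine hr ?_
    rw [uIoc_of_le hs.1] at hrI
    rw [uIoc_of_le ht.2]
    exact ⟨hrI.1, hrI.2.trans hs.2⟩

theorem stateOf_congr (h : ∀ᵐ t, t ∈ Ioo 0 T → w t = w' t) {t : ℝ} (ht : t ∈ Icc 0 T)
    (y : EuclideanSpace ℝ (Fin N)) : stateOf f w T t y = stateOf f w' T t y := by
  have h' : ∀ᵐ t, t ∈ Ioo 0 T → w' t = w t := by
    filter_upwards [h] with t ht hT using (ht hT).symm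
  have : IsState f w T t y = IsState f w' T t y := by
    funext x
    exact propext ⟨IsState.congr h ht, IsState.congr h' ht⟩
  rw [stateOf, stateOf, this]

theorem feedbackCost_congr (h : ∀ᵐ t, t ∈ Ioo 0 T → w t = w' t) {t : ℝ} (ht : t ∈ Icc 0 T)
    (y : EuclideanSpace ℝ (Fin N)) : feedbackCost F f T t y w = feedbackCost F f T t y w' := by
  rw [feedbackCost, feedbackCost, stateOf_congr h ht y]
  refine intervalIntegral.integral_congr_ae ?_
  filter_upwards [h, ae_mem_uIoc_imp_mem_Ioo ht] with r hr hr' hrI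
  rw [hr (hr' hrI).2]

theorem isState_stateOf {t : ℝ} {y : EuclideanSpace ℝ (Fin N)}
    (h : ∃ x, IsState f w T t y x) : IsState f w T t y (stateOf f w T t y) :=
  Classical.epsilon_spec h

theorem IsState.isTrajectory {t : ℝ} {y : EuclideanSpace ℝ (Fin N)}
    {x : ℝ → EuclideanSpace ℝ (Fin N)} (hx : IsState f w T t y x) (htT : t ≤ T) :
    IsTrajectory (closedLoop f w) t T x ∧ x t = y := by
  have h : x t = y := by simpa using hx.eq_integral t (left_mem_Icc.2 htT)
  exact ⟨⟨hx.continuousOn, fun s hs => by rw [h]; exact hx.eq_integral s hs⟩, h⟩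

theorem IsTrajectory.isState (hw : IsCaratheodoryField (closedLoop f w)) {t : ℝ}
    {x : ℝ → EuclideanSpace ℝ (Fin N)} (hx : IsTrajectory (closedLoop f w) t T x) (htT : t ≤ T) :
    IsState f w T t (x t) x :=
  ⟨hx.continuousOn, hw.intervalIntegrable htT hx.continuousOn, hx.eq_integral⟩

theorem IsCostate.isAdjointState (hp : IsCostate F f T u p) :
    IsAdjointState (closedLoop f u) (closedLoop F u) T volume p :=
  ⟨hp.locallyLipschitz, hp.transport, hp.terminal⟩

theorem IsCostate.congr (hp : IsCostate F f T u p) (h : ∀ᵐ t, t ∈ Ioo 0 T → u t = w t) :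
    IsCostate F f T w p := by
  refine ⟨hp.locallyLipschitz, ?_, hp.terminal⟩
  have h1 : ∀ᵐ z : ℝ × EuclideanSpace ℝ (Fin N), z.1 ∈ Ioo 0 T → u z.1 = w z.1 :=
    Measure.quasiMeasurePreserving_fst.ae h
  filter_upwards [hp.transport, h1] with z hz hz1 hT
  rw [← hz1 hT]
  exact hz hT

/-- The verification identity: the excess cost of an arbitrary feedback `w` over `u` is the integral
of the excess of the hamiltonian along the state of `w`. -/
theorem feedbackCost_eq_add_integral_hamiltonian (hK : IsCompact K)
    (hF : ∀ x, ∀ v ∈ K, ContDiffAt ℝ 1 (Function.uncurry F) (x, v))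
    (hf : ∀ x, ∀ v ∈ K, ContDiffAt ℝ 1 (Function.uncurry f) (x, v)) {L L' : ℝ≥0}
    (hu : IsRegularControl K L u) (hex : ∀ t ∈ Icc 0 T, ∀ y, ∃ x, IsState f u T t y x)
    (hp : IsCostate F f T u p) (hw : IsRegularControl K L' w) {t : ℝ} (ht : t ∈ Icc 0 T)
    {y : EuclideanSpace ℝ (Fin N)} (hX : ∃ x, IsState f w T t y x) :
    IntervalIntegrable (fun r =>
      hamiltonian F f p r (stateOf f w T t y r) (w r (stateOf f w T t y r))
        - hamiltonian F f p r (stateOf f w T t y r) (u r (stateOf f w T t y r))) volume t T ∧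
    feedbackCost F f T t y w = feedbackCost F f T t y u
      + ∫ r in t..T, (hamiltonian F f p r (stateOf f w T t y r) (w r (stateOf f w T t y r))
        - hamiltonian F f p r (stateOf f w T t y r) (u r (stateOf f w T t y r))) := by
  obtain ⟨hXT, hXt⟩ := (isState_stateOf hX).isTrajectory ht.2
  set X := stateOf f w T t y with hXdef
  have hfu := hu.isCaratheodoryField hK hf
  have hFu := hu.isCaratheodoryField hK hF
  have hfw := hw.isCaratheodoryField hK hf
  have hFw := hw.isCaratheodoryField hK hF
  have hflow : ∀ t ∈ Icc 0 T, IsFlowFrom (closedLoop f u) t T (stateOf f u T t) :=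
    fun t ht y => (isState_stateOf (hex t ht y)).isTrajectory ht.2
  obtain ⟨R, -, hR⟩ := hXT.continuousOn.exists_norm_le_Icc
  obtain ⟨M, hM⟩ := hfw.bounded R
  obtain ⟨h1, h2⟩ := hp.isAdjointState.value_eq_integral hfu hFu (Φ := fun t => stateOf f u T t)
    hflow ht (X := X) (w := fun r => closedLoop f w r (X r)) (Mw := M)
    (hfw.intervalIntegrable ht.2 hXT.continuousOn)
    (fun r hr => hM r _ (by simpa using hR r hr)) hXT.eq_integral
  have h3 := hFw.intervalIntegrable ht.2 hXT.continuousOn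
  have heq : (fun r => hamiltonian F f p r (X r) (w r (X r))
      - hamiltonian F f p r (X r) (u r (X r)))
      = fun r => closedLoop F w r (X r) - (closedLoop F u r (X r)
        + inner ℝ (p r (X r)) (closedLoop f w r (X r) - closedLoop f u r (X r))) := by
    funext r
    simp only [hamiltonian, inner_sub_right]
    ring
  rw [heq]
  refine ⟨h3.sub h1, ?_⟩
  rw [intervalIntegral.integral_sub h3 h1, ← h2, hXt]
  simp only [feedbackCost, ← hXdef]
  ring

/-- For small `ε`, the variation `u + ε (U - u)` has a state, and this state is `O(ε)`-close to
that of `u`. -/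
theorem exists_isState_variationField (hK : IsCompact K) (hKc : Convex ℝ K)
    (hf : ∀ x, ∀ v ∈ K, ContDiffAt ℝ 1 (Function.uncurry f) (x, v)) {L L' : ℝ≥0}
    (hu : IsRegularControl K L u) (hU : IsRegularControl K L' U) {t : ℝ} (htT : t ≤ T)
    {y : EuclideanSpace ℝ (Fin N)} (hx : ∃ x, IsState f u T t y x) :
    ∃ B : ℝ, ∃ ε₀ ∈ Ioc (0 : ℝ) 1, ∀ ε ∈ Icc 0 ε₀, (∃ x, IsState f (variationField u U ε) T t y x) ∧
      ∀ s ∈ Icc t T, ‖stateOf f (variationField u U ε) T t y s - stateOf f u T t y s‖ ≤ B * ε := by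
  obtain ⟨hxT, hxt⟩ := (isState_stateOf hx).isTrajectory htT
  set x := stateOf f u T t y with hxdef
  obtain ⟨R, hR0, hR⟩ := hxT.continuousOn.exists_norm_le_Icc
  obtain ⟨C, hC⟩ := exists_lipschitzOnWith_closedBall_prod hK hf (R + 1)
  obtain ⟨Kb, hKb⟩ := hK.isBounded.exists_norm_le
  set Λ : ℝ≥0 := C * max 1 (L + (L' + L)) with hΛ
  set A : ℝ := C * (2 * Kb) with hA
  have hKb0 : 0 ≤ Kb := (norm_nonneg _).trans (hKb _ (hu.mem 0 0))
  have hA0 : 0 ≤ A := by positivity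
  set B : ℝ := A * (T - t) * Real.exp (Λ * (T - t)) with hB
  have hB0 : 0 ≤ B := mul_nonneg (mul_nonneg hA0 (sub_nonneg.2 htT)) (Real.exp_pos _).le
  have hε₀ : 1 / (B + 1) ≤ 1 := by rw [div_le_one (by positivity)]; linarith
  refine ⟨B, 1 / (B + 1), ⟨by positivity, hε₀⟩, fun ε hε => ?_⟩
  have hw : IsRegularControl K (L + (L' + L)) (variationField u U ε) :=
    hu.variation hKc hU ⟨hε.1, hε.2.trans hε₀⟩
  have hfw := hw.isCaratheodoryField hK hf
  have hfu := hu.isCaratheodoryField hK hf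
  have hL := hw.lipschitzOnWith_closedLoop hC
  have hlt : B * ε < 1 := by
    have h1 := hε.2
    rw [le_div_iff₀ (by positivity)] at h1
    rcases hε.1.eq_or_lt with h0 | h0
    · rw [← h0]; simp
    · linarith
  have hM : ∀ r ∈ Icc t T, ‖closedLoop f u r (x r) - closedLoop f (variationField u U ε) r (x r)‖
      ≤ A * ε := fun r hr => by
    have hxm : x r ∈ Metric.closedBall (0 : EuclideanSpace ℝ (Fin N)) (R + 1) := by
      rw [mem_closedBall_zero_iff]; linarith [hR r hr]
    have h1 := hC.norm_sub_le (x := (x r, u r (x r))) ⟨hxm, hu.mem _ _⟩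
      (y := (x r, variationField u U ε r (x r))) ⟨hxm, hw.mem _ _⟩
    refine h1.trans ?_
    have h2 : ‖((x r, u r (x r)) : EuclideanSpace ℝ (Fin N) × EuclideanSpace ℝ (Fin m))
        - (x r, variationField u U ε r (x r))‖ = ε * ‖U r (x r) - u r (x r)‖ := by
      have h0 := mul_nonneg hε.1 (norm_nonneg (U r (x r) - u r (x r)))
      simp [variationField, norm_smul, abs_of_nonneg hε.1, h0]
    have h3 : ‖U r (x r) - u r (x r)‖ ≤ 2 * Kb := (norm_sub_le _ _).trans (by
      linarith [hKb _ (hU.mem r (x r)), hKb _ (hu.mem r (x r))])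
    rw [h2, hA, mul_assoc, mul_comm (2 * Kb)]
    exact mul_le_mul_of_nonneg_left (mul_le_mul_of_nonneg_left h3 hε.1) C.2
  have hbound : (‖y - x t‖ + A * ε * (T - t)) * Real.exp (Λ * (T - t)) ≤ B * ε := by
    rw [hxt, sub_self, norm_zero, zero_add, hB]
    exact le_of_eq (by ring)
  have hwi := hfu.intervalIntegrable htT hxT.continuousOn
  have hAε : 0 ≤ A * ε := mul_nonneg hA0 hε.1
  obtain ⟨z, hz, hzt⟩ := hfw.exists_isTrajectory_near htT hL hxT.continuousOn hR hwi
    hxT.eq_integral hM hAε hbound hlt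
  have hst : ∃ x, IsState f (variationField u U ε) T t y x := ⟨z, hzt ▸ hz.isState hfw htT⟩
  refine ⟨hst, ?_⟩
  obtain ⟨hz', hzt'⟩ := (isState_stateOf hst).isTrajectory htT
  exact hz'.norm_sub_le hfw hL hxT.continuousOn hR hwi hxT.eq_integral hM hAε
    (by rw [hzt']; exact hbound) hlt

theorem fderiv_snd_apply {W : Type*} [NormedAddCommGroup W] [NormedSpace ℝ W]
    {φ : EuclideanSpace ℝ (Fin N) → EuclideanSpace ℝ (Fin m) → W}
    {x : EuclideanSpace ℝ (Fin N)} {v : EuclideanSpace ℝ (Fin m)}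
    (h : DifferentiableAt ℝ (Function.uncurry φ) (x, v)) (d : EuclideanSpace ℝ (Fin m)) :
    fderiv ℝ (φ x) v d = fderiv ℝ (Function.uncurry φ) (x, v) (0, d) := by
  have h1 : HasFDerivAt (φ x) ((fderiv ℝ (Function.uncurry φ) (x, v)).comp
      (ContinuousLinearMap.inr ℝ _ _)) v :=
    h.hasFDerivAt.comp (f := fun q => (x, q)) v (hasFDerivAt_prodMk_right x v)
  rw [h1.fderiv]
  simp

/-- The first variation of the cost. By the verification identity, only difference quotients of the
hamiltonian in the control have to be passed to the limit, and no derivative of the state with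
respect to `ε` is involved. -/
theorem hasDerivWithinAt_feedbackCost (hK : IsCompact K) (hKc : Convex ℝ K)
    (hF : ∀ x, ∀ v ∈ K, ContDiffAt ℝ 1 (Function.uncurry F) (x, v))
    (hf : ∀ x, ∀ v ∈ K, ContDiffAt ℝ 1 (Function.uncurry f) (x, v)) {L L' : ℝ≥0}
    (hu : IsRegularControl K L u) (hex : ∀ t ∈ Icc 0 T, ∀ y, ∃ x, IsState f u T t y x)
    (hp : IsCostate F f T u p) (hU : IsRegularControl K L' U) {t : ℝ} (ht : t ∈ Icc 0 T)
    (y : EuclideanSpace ℝ (Fin N)) :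
    IntervalIntegrable (fun s => costGradient F f p u s (stateOf f u T t y s)
        (U s (stateOf f u T t y s) - u s (stateOf f u T t y s))) volume t T ∧
      HasDerivWithinAt (fun ε : ℝ => feedbackCost F f T t y (variationField u U ε))
        (∫ s in t..T, costGradient F f p u s (stateOf f u T t y s)
          (U s (stateOf f u T t y s) - u s (stateOf f u T t y s))) (Ici 0) 0 := by
  have htT := ht.2
  obtain ⟨B, ε₀, hε₀, hB⟩ := exists_isState_variationField hK hKc hf hu hU htT (hex t ht y)
  obtain ⟨hxT, hxt⟩ := (isState_stateOf (hex t ht y)).isTrajectory htT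
  set x := stateOf f u T t y with hxdef
  set X : ℝ → ℝ → EuclideanSpace ℝ (Fin N) := fun ε => stateOf f (variationField u U ε) T t y
    with hX
  have hreg : ∀ ε ∈ Icc 0 ε₀, IsRegularControl K (L + (L' + L)) (variationField u U ε) :=
    fun ε hε => hu.variation hKc hU ⟨hε.1, hε.2.trans hε₀.2⟩
  set h : ℝ → ℝ → ℝ := fun ε r => hamiltonian F f p r (X ε r) (variationField u U ε r (X ε r))
    - hamiltonian F f p r (X ε r) (u r (X ε r)) with hh
  have hcost : ∀ ε ∈ Icc 0 ε₀, IntervalIntegrable (h ε) volume t T ∧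
      feedbackCost F f T t y (variationField u U ε) = feedbackCost F f T t y u
        + ∫ r in t..T, h ε r := fun ε hε =>
    feedbackCost_eq_add_integral_hamiltonian hK hF hf hu hex hp (hreg ε hε) ht (hB ε hε).1
  -- uniform bounds on a ball that contains all the states
  obtain ⟨R, hR0, hR⟩ := hxT.continuousOn.exists_norm_le_Icc
  set R' : ℝ := R + |B| with hR'
  have hXm : ∀ ε ∈ Icc 0 ε₀, ∀ r ∈ Icc t T,
      X ε r ∈ Metric.closedBall (0 : EuclideanSpace ℝ (Fin N)) R' := fun ε hε r hr => by
    rw [mem_closedBall_zero_iff]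
    have h1 := norm_add_le (x r) (X ε r - x r)
    rw [add_sub_cancel] at h1
    have h2 := (hB ε hε).2 r hr
    have h3 : B * ε ≤ |B| * 1 :=
      mul_le_mul (le_abs_self B) (hε.2.trans hε₀.2) hε.1 (abs_nonneg B)
    linarith [hR r hr]
  obtain ⟨CF, hCF⟩ := exists_lipschitzOnWith_closedBall_prod hK hF R'
  obtain ⟨Cf, hCf⟩ := exists_lipschitzOnWith_closedBall_prod hK hf R'
  obtain ⟨Cp, hCp⟩ := hp.isAdjointState.exists_lipschitzOnWith R'
  obtain ⟨Q, hQ⟩ := (isCompact_Icc.prod (isCompact_closedBall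
    (0 : EuclideanSpace ℝ (Fin N)) R')).exists_bound_of_continuousOn hCp.continuousOn
  obtain ⟨Kb, hKb⟩ := hK.isBounded.exists_norm_le
  have h0t : ∀ r ∈ Icc t T, r ∈ Icc 0 T := fun r hr => ⟨ht.1.trans hr.1, hr.2⟩
  have hQ0 : 0 ≤ Q := (norm_nonneg _).trans (hQ (t, X 0 t)
    ⟨ht, hXm 0 ⟨le_rfl, hε₀.1.le⟩ t (left_mem_Icc.2 htT)⟩)
  set A : ℝ := (CF + Q * Cf) * (2 * Kb) with hA
  have hbound : ∀ ε ∈ Ioc 0 ε₀, ∀ r ∈ Icc t T, ‖ε⁻¹ * h ε r‖ ≤ A := by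
    intro ε hε r hr
    have hε' : ε ∈ Icc 0 ε₀ := Ioc_subset_Icc_self hε
    have hm := hXm ε hε' r hr
    have hd : ‖((X ε r, variationField u U ε r (X ε r)) :
        EuclideanSpace ℝ (Fin N) × EuclideanSpace ℝ (Fin m)) - (X ε r, u r (X ε r))‖
        ≤ ε * (2 * Kb) := by
      have h1 : ‖U r (X ε r) - u r (X ε r)‖ ≤ 2 * Kb := (norm_sub_le _ _).trans (by
        linarith [hKb _ (hU.mem r (X ε r)), hKb _ (hu.mem r (X ε r))])
      have h2 := mul_le_mul_of_nonneg_left h1 hε.1.le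
      have h0 : 0 ≤ ε * (2 * Kb) := (mul_nonneg hε.1.le (norm_nonneg _)).trans h2
      simpa [variationField, norm_smul, abs_of_pos hε.1, h0] using h2
    have hFb := (hCF.norm_sub_le (x := (X ε r, variationField u U ε r (X ε r)))
      ⟨hm, (hreg ε hε').mem _ _⟩ (y := (X ε r, u r (X ε r))) ⟨hm, hu.mem _ _⟩).trans
      (mul_le_mul_of_nonneg_left hd CF.2)
    have hfb := (hCf.norm_sub_le (x := (X ε r, variationField u U ε r (X ε r)))
      ⟨hm, (hreg ε hε').mem _ _⟩ (y := (X ε r, u r (X ε r))) ⟨hm, hu.mem _ _⟩).trans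
      (mul_le_mul_of_nonneg_left hd Cf.2)
    simp only [Function.uncurry_apply_pair] at hFb hfb
    have heq : h ε r = (F (X ε r) (variationField u U ε r (X ε r)) - F (X ε r) (u r (X ε r)))
        - inner ℝ (p r (X ε r))
          (f (X ε r) (variationField u U ε r (X ε r)) - f (X ε r) (u r (X ε r))) := by
      simp only [hh, hamiltonian, inner_sub_right]; ring
    have hle : ‖h ε r‖ ≤ ε * A := by
      rw [heq]
      refine (norm_sub_le _ _).trans ((add_le_add hFb ((norm_inner_le_norm _ _).trans
        (mul_le_mul (hQ (r, X ε r) ⟨h0t r hr, hm⟩) hfb (norm_nonneg _) hQ0))).trans (le_of_eq ?_))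
      rw [hA]
      ring
    rw [norm_mul, norm_inv, Real.norm_of_nonneg hε.1.le, inv_mul_le_iff₀ hε.1]
    exact hle
  -- pointwise convergence of the difference quotients
  set D : ℝ → ℝ := fun s => costGradient F f p u s (x s) (U s (x s) - u s (x s)) with hD
  have hIoc : Ioc 0 ε₀ ∈ 𝓝[>] (0 : ℝ) := Ioc_mem_nhdsGT hε₀.1
  have hptw : ∀ r ∈ Icc t T, Tendsto (fun ε => ε⁻¹ * h ε r) (𝓝[>] 0) (𝓝 (D r)) := by
    intro r hr
    have hXr : Tendsto (fun ε => X ε r) (𝓝[>] 0) (𝓝 (x r)) := by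
      rw [tendsto_iff_norm_sub_tendsto_zero]
      have hlim : Tendsto (fun ε : ℝ => B * ε) (𝓝[>] 0) (𝓝 0) := by
        have h1 : Tendsto (fun ε : ℝ => B * ε) (𝓝 0) (𝓝 (B * 0)) := tendsto_id.const_mul B
        rw [mul_zero] at h1
        exact h1.mono_left nhdsWithin_le_nhds
      refine squeeze_zero' (Eventually.of_forall fun _ => norm_nonneg _) ?_ hlim
      filter_upwards [hIoc] with ε hε using (hB ε (Ioc_subset_Icc_self hε)).2 r hr
    have huX : Tendsto (fun ε => u r (X ε r)) (𝓝[>] 0) (𝓝 (u r (x r))) :=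
      ((hu.lipschitz r).continuous.tendsto _).comp hXr
    have hUX : Tendsto (fun ε => U r (X ε r)) (𝓝[>] 0) (𝓝 (U r (x r))) :=
      ((hU.lipschitz r).continuous.tendsto _).comp hXr
    have hpX : Tendsto (fun ε => p r (X ε r)) (𝓝[>] 0) (𝓝 (p r (x r))) :=
      ((hp.isAdjointState.continuous (h0t r hr)).tendsto _).comp hXr
    have hFs := (hF (x r) _ (hu.mem r (x r))).hasStrictFDerivAt one_ne_zero
    have hfs := (hf (x r) _ (hu.mem r (x r))).hasStrictFDerivAt one_ne_zero
    have h1 := hFs.tendsto_slope_snd hXr huX (hUX.sub huX)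
    have h2 := hfs.tendsto_slope_snd hXr huX (hUX.sub huX)
    have h3 := h1.sub (hpX.inner h2)
    have h4 : D r = fderiv ℝ (Function.uncurry F) (x r, u r (x r)) (0, U r (x r) - u r (x r))
        - inner ℝ (p r (x r))
          (fderiv ℝ (Function.uncurry f) (x r, u r (x r)) (0, U r (x r) - u r (x r))) := by
      simp only [hD, costGradient, sub_apply, ContinuousLinearMap.comp_apply,
        innerSL_apply_apply]
      rw [fderiv_snd_apply hFs.hasFDerivAt.differentiableAt,
        fderiv_snd_apply hfs.hasFDerivAt.differentiableAt]
    rw [h4]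
    refine h3.congr fun ε => ?_
    simp only [hh, hamiltonian, variationField, Function.uncurry_apply_pair, smul_eq_mul,
      inner_smul_right, inner_sub_right]
    ring
  have hmeas : ∀ ε ∈ Ioc 0 ε₀,
      AEStronglyMeasurable (fun r => ε⁻¹ * h ε r) (volume.restrict (uIoc t T)) := fun ε hε => by
    rw [uIoc_of_le htT]
    exact ((hcost ε (Ioc_subset_Icc_self hε)).1.aestronglyMeasurable).const_mul _
  have hDb : ∀ r ∈ Icc t T, ‖D r‖ ≤ A := fun r hr =>
    le_of_tendsto (hptw r hr).norm (by filter_upwards [hIoc] with ε hε using hbound ε hε r hr)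
  have hDi : IntervalIntegrable D volume t T := by
    obtain ⟨e, -, heI, he⟩ := exists_seq_strictAnti_tendsto' hε₀.1
    have he' : Tendsto e atTop (𝓝[>] 0) :=
      tendsto_nhdsWithin_iff.2 ⟨he, Eventually.of_forall fun n => (heI n).1⟩
    have hDm : AEStronglyMeasurable D (volume.restrict (uIoc t T)) := by
      refine aestronglyMeasurable_of_tendsto_ae atTop
        (fun n => hmeas (e n) (Ioo_subset_Ioc_self (heI n)))
        ((ae_restrict_iff' measurableSet_uIoc).2 (ae_of_all _ fun r hr => ?_))
      rw [uIoc_of_le htT] at hr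
      exact (hptw r (Ioc_subset_Icc_self hr)).comp he'
    refine intervalIntegrable_of_norm_le htT (M := A) ?_ hDb
    rw [uIoc_of_le htT] at hDm
    rwa [← Measure.restrict_congr_set Ioc_ae_eq_Icc]
  refine ⟨hDi, ?_⟩
  have hlim : Tendsto (fun ε => ∫ r in t..T, ε⁻¹ * h ε r) (𝓝[>] 0) (𝓝 (∫ r in t..T, D r)) := by
    refine intervalIntegral.tendsto_integral_filter_of_dominated_convergence (fun _ => A) ?_ ?_
      intervalIntegrable_const (ae_of_all _ fun r hr => ?_)
    · filter_upwards [hIoc] with ε hε using hmeas ε hε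
    · filter_upwards [hIoc] with ε hε
      refine ae_of_all _ fun r hr => ?_
      rw [uIoc_of_le htT] at hr
      exact hbound ε hε r (Ioc_subset_Icc_self hr)
    · rw [uIoc_of_le htT] at hr
      exact hptw r (Ioc_subset_Icc_self hr)
  rw [← hasDerivWithinAt_Ioi_iff_Ici, hasDerivWithinAt_iff_tendsto_slope' self_notMem_Ioi]
  refine hlim.congr' ?_
  filter_upwards [hIoc] with ε hε
  have hzero : variationField u U 0 = u := by
    funext s z; simp [variationField]
  rw [slope_def_field, (hcost ε (Ioc_subset_Icc_self hε)).2, hzero,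
    intervalIntegral.integral_const_mul, add_sub_cancel_left, sub_zero, div_eq_inv_mul]

end Cost

/-! ### Optimality -/

theorem feedbackCost_le_of_isMinOn {N m : ℕ} {K : Set (EuclideanSpace ℝ (Fin m))} {T : ℝ}
    {F : EuclideanSpace ℝ (Fin N) → EuclideanSpace ℝ (Fin m) → ℝ}
    {f : EuclideanSpace ℝ (Fin N) → EuclideanSpace ℝ (Fin m) → EuclideanSpace ℝ (Fin N)}
    {u w : FeedbackField (EuclideanSpace ℝ (Fin N)) (EuclideanSpace ℝ (Fin m))}
    {p : FeedbackField (EuclideanSpace ℝ (Fin N)) (EuclideanSpace ℝ (Fin N))} (hK : IsCompact K)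
    (hF : ∀ x, ∀ v ∈ K, ContDiffAt ℝ 1 (Function.uncurry F) (x, v))
    (hf : ∀ x, ∀ v ∈ K, ContDiffAt ℝ 1 (Function.uncurry f) (x, v)) {L L' : ℝ≥0}
    (hu : IsRegularControl K L u) (hex : ∀ t ∈ Icc 0 T, ∀ y, ∃ x, IsState f u T t y x)
    (hp : IsCostate F f T u p)
    (hmin : ∀ᵐ t, t ∈ Ioo 0 T → ∀ x, IsMinOn (hamiltonian F f p t x) K (u t x))
    (hw : IsRegularControl K L' w) {t : ℝ} (ht : t ∈ Icc 0 T)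
    {y : EuclideanSpace ℝ (Fin N)} (hX : ∃ x, IsState f w T t y x) :
    feedbackCost F f T t y u ≤ feedbackCost F f T t y w := by
  rw [(feedbackCost_eq_add_integral_hamiltonian hK hF hf hu hex hp hw ht hX).2]
  refine le_add_of_nonneg_right (intervalIntegral.integral_nonneg_of_ae_restrict ht.2 ?_)
  have hae := ae_mem_uIoc_imp_mem_Ioo ht
  rw [uIoc_of_le ht.2] at hae
  rw [← Measure.restrict_congr_set Ioc_ae_eq_Icc]
  refine (ae_restrict_iff' measurableSet_Ioc).2 ?_
  filter_upwards [hmin, hae] with r h1 h2 hr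
  exact sub_nonneg.2 (h1 (h2 hr).2 _ (hw.mem _ _))

theorem mainTheorem6 {N m : ℕ} (T : ℝ) (hT : 0 < T)
    (K : Set (EuclideanSpace ℝ (Fin m))) (hK : IsCompact K) (hKc : Convex ℝ K)
    (F : EuclideanSpace ℝ (Fin N) → EuclideanSpace ℝ (Fin m) → ℝ)
    (f : EuclideanSpace ℝ (Fin N) → EuclideanSpace ℝ (Fin m) → EuclideanSpace ℝ (Fin N))
    (hF : ∀ x, ∀ v ∈ K, ContDiffAt ℝ 1 (Function.uncurry F) (x, v))
    (hf : ∀ x, ∀ v ∈ K, ContDiffAt ℝ 1 (Function.uncurry f) (x, v))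
    (u : FeedbackField (EuclideanSpace ℝ (Fin N)) (EuclideanSpace ℝ (Fin m)))
    (hu : IsFeasible f K T u)
    (p : FeedbackField (EuclideanSpace ℝ (Fin N)) (EuclideanSpace ℝ (Fin N)))
    (hp : IsCostate F f T u p)
    (hmin : ∀ᵐ t, t ∈ Ioo 0 T → ∀ x, IsMinOn (hamiltonian F f p t x) K (u t x)) :
    (∀ U, IsFeasible f K T U → ∀ t ∈ Icc 0 T, ∀ y,
      (∀ᶠ ε in 𝓝[≥] (0 : ℝ), ∃ x, IsState f (variationField u U ε) T t y x) ∧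
      IntervalIntegrable (fun s => costGradient F f p u s (stateOf f u T t y s)
        (U s (stateOf f u T t y s) - u s (stateOf f u T t y s))) volume t T ∧
      HasDerivWithinAt (fun ε : ℝ => feedbackCost F f T t y (variationField u U ε))
        (∫ s in t..T, costGradient F f p u s (stateOf f u T t y s)
          (U s (stateOf f u T t y s) - u s (stateOf f u T t y s))) (Ici 0) 0 ∧
      0 ≤ ∫ s in t..T, costGradient F f p u s (stateOf f u T t y s)
          (U s (stateOf f u T t y s) - u s (stateOf f u T t y s))) ∧
    IsLocalMinFeedback F f K T u := by
  obtain ⟨Lu, hLu⟩ := hu.lipschitz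
  have hKne : K.Nonempty := by
    have hvol : volume (Ioo 0 T) ≠ 0 := by simp [hT]
    obtain ⟨t, ht, hmem⟩ := ((frequently_ae_mem_iff.2 hvol).and_eventually hu.mem).exists
    exact ⟨_, hmem ht 0⟩
  obtain ⟨u', hu', huu⟩ := exists_isRegularControl hKne hu.aemeasurable hu.mem hLu
  have huu' : ∀ᵐ t, t ∈ Ioo 0 T → u t = u' t := by
    filter_upwards [huu] with t ht hT' using (ht hT').symm
  have hp' := hp.congr huu'
  have hex : ∀ t ∈ Icc 0 T, ∀ y, ∃ x, IsState f u' T t y x := fun t ht y =>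
    (hu.exists_state t ht y).imp fun x hx => hx.congr huu' ht
  have hmin' : ∀ᵐ t, t ∈ Ioo 0 T → ∀ x, IsMinOn (hamiltonian F f p t x) K (u' t x) := by
    filter_upwards [hmin, huu] with t h1 h2 hT' x
    rw [h2 hT']
    exact h1 hT' x
  refine ⟨fun U hU t ht y => ?_, hu, 1, one_pos, fun U hU _ t ht y => ?_⟩
  · obtain ⟨LU, hLU⟩ := hU.lipschitz
    obtain ⟨U', hU', hUU⟩ := exists_isRegularControl hKne hU.aemeasurable hU.mem hLU
    have hvar : ∀ ε, ∀ᵐ t, t ∈ Ioo 0 T → variationField u' U' ε t = variationField u U ε t := by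
      intro ε
      filter_upwards [huu, hUU] with t h1 h2 hT'
      funext x
      simp only [variationField, h1 hT', h2 hT']
    have hst : stateOf f u' T t y = stateOf f u T t y := stateOf_congr huu ht y
    obtain ⟨B, ε₀, hε₀, hB⟩ := exists_isState_variationField hK hKc hf hu' hU' ht.2 (hex t ht y)
    obtain ⟨hi, hd⟩ := hasDerivWithinAt_feedbackCost hK hKc hF hf hu' hex hp' hU' ht y
    have hgrad : ∀ᵐ s, s ∈ uIoc t T → costGradient F f p u' s (stateOf f u' T t y s)
        (U' s (stateOf f u' T t y s) - u' s (stateOf f u' T t y s))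
        = costGradient F f p u s (stateOf f u T t y s)
        (U s (stateOf f u T t y s) - u s (stateOf f u T t y s)) := by
      filter_upwards [huu, hUU, ae_mem_uIoc_imp_mem_Ioo ht] with s h1 h2 h3 hs
      rw [hst]
      simp only [costGradient, h1 (h3 hs).2, h2 (h3 hs).2]
    have hcost : (fun ε => feedbackCost F f T t y (variationField u' U' ε))
        = fun ε => feedbackCost F f T t y (variationField u U ε) :=
      funext fun ε => feedbackCost_congr (hvar ε) ht y
    have hd' := hd
    rw [hcost, intervalIntegral.integral_congr_ae hgrad] at hd'
    refine ⟨?_, hi.congr_ae ((ae_restrict_iff' measurableSet_uIoc).2 hgrad), hd', ?_⟩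
    · filter_upwards [Icc_mem_nhdsGE hε₀.1] with ε hε
      exact (hB ε hε).1.imp fun x hx => hx.congr (hvar ε) ht
    · rw [← intervalIntegral.integral_congr_ae hgrad]
      rw [← hasDerivWithinAt_Ioi_iff_Ici, hasDerivWithinAt_iff_tendsto_slope' self_notMem_Ioi]
        at hd
      refine ge_of_tendsto hd ?_
      filter_upwards [Ioc_mem_nhdsGT hε₀.1] with ε hε
      have hzero : variationField u' U' 0 = u' := by
        funext s z; simp [variationField]
      rw [slope_def_field, hzero, sub_zero]
      refine div_nonneg (sub_nonneg.2 ?_) hε.1.le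
      exact feedbackCost_le_of_isMinOn hK hF hf hu' hex hp' hmin'
        (hu'.variation hKc hU' ⟨hε.1.le, hε.2.trans hε₀.2⟩) ht
        (hB ε (Ioc_subset_Icc_self hε)).1
  · obtain ⟨LU, hLU⟩ := hU.lipschitz
    obtain ⟨U', hU', hUU⟩ := exists_isRegularControl hKne hU.aemeasurable hU.mem hLU
    have hUU' : ∀ᵐ t, t ∈ Ioo 0 T → U t = U' t := by
      filter_upwards [hUU] with t ht hT' using (ht hT').symm
    rw [feedbackCost_congr huu' ht, feedbackCost_congr hUU' ht]
    exact feedbackCost_le_of_isMinOn hK hF hf hu' hex hp' hmin' hU' ht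
      ((hU.exists_state t ht y).imp fun x hx => hx.congr hUU' ht)
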